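/- Let $p,q\in\mathbb{N}_0$, let $\mathbf{A}=(A_1,\dots,A_p)$, $\mathbf{B}=(B_1,\dots,B_q)$ be vectors of positive reals and $\mathbf{a}=(a_1,\dots,a_p)$, $\mathbf{b}=(b_1,\dots,b_q)$ vectors of nonnegative reals. Put $$\Delta=\sum_{j=1}^q B_j-\sum_{k=1}^p A_k,\qquad \rho=\prod_{k=1}^p A_k^{A_k}\prod_{j=1}^q B_j^{-B_j},\qquad \mu=\sum_{j=1}^q b_j-\sum_{k=1}^p a_k+\frac{p-q}{2},$$ $$\nu=(2\pi)^{(p-q)/2}\prod_{k=1}^p A_k^{a_k-1/2}\prod_{j=1}^q B_j^{1/2-b_j},\qquad Q(u)=\sum_{i=1}^p\frac{u^{a_i/A_i}}{1-u^{1/A_i}}-\sum_{j=1}^q\frac{u^{b_j/B_j}}{1-u^{1/B_j}}\quad(0<u<1).$$ Let $H$ be Fox's function $$H(x)=H^{p,0}_{q,p}\left(x\,\middle|\,\begin{array}{c}(\mathbf{B},\mathbf{b})\\(\mathbf{A},\mathbf{a})\end{array}\right)=\frac{1}{2\pi i}\int_{\mathcal{L}}\frac{\prod_{k=1}^p\Gamma(A_ks+a_k)}{\prod_{j=1}^q\Gamma(B_js+b_j)}\,x^{-s}\,ds,$$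 where $\mathcal{L}$ is a left loop that runs along straight segments from $-\infty+i\varphi_1$ to $c+i\varphi_1$, then to $c+i\varphi_2$, then to $-\infty+i\varphi_2$; here $\varphi_1<0<\varphi_2$ and $c>-a_k/A_k$ for all $k$, so that all the poles of the numerator lie inside the loop. Suppose that $\mu=0$, $\rho\le 1$ and $\Delta=0$. Then, for every such loop $\mathcal{L}$ and every $x\in(0,\rho)$, the integral that defines $H(x)$ converges absolutely, the function $u\mapsto H(u)\,Q(x/u)/u$ is integrable over $(x,\rho)$, and $$H(x)=\frac{1}{\log(\rho/x)}\left(\nu\,Q(x/\rho)+\int_x^{\rho}H(u)\,\frac{Q(x/u)}{u}\,du\right).$$ -/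

import Mathlib

noncomputable section

namespace FoxH

/-- The gamma ratio `∏ₖ Γ(Aₖ s + aₖ) / ∏ⱼ Γ(Bⱼ s + bⱼ)`. Where a denominator factor has a pole,
Mathlib's `Complex.Gamma` is `0`, so that its reciprocal is `0`, which is the value there of the
entire function `1 / Γ`. -/
def gammaRatio {p q : ℕ} (A a : Fin p → ℝ) (B b : Fin q → ℝ) (s : ℂ) : ℂ :=
  (∏ k, Complex.Gamma ((A k : ℂ) * s + (a k : ℂ))) /
    ∏ j, Complex.Gamma ((B j : ℂ) * s + (b j : ℂ))

/-- The integral of `F` along the left loop that runs from `-∞ + i φ₁` horizontally to `c + i φ₁`,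
then vertically up to `c + i φ₂`, then horizontally back to `-∞ + i φ₂`. -/
def leftLoopIntegral (c φ₁ φ₂ : ℝ) (F : ℂ → ℂ) : ℂ :=
  (∫ t in Set.Iic c, F ((t : ℂ) + (φ₁ : ℂ) * Complex.I))
    + Complex.I * (∫ t in φ₁..φ₂, F ((c : ℂ) + (t : ℂ) * Complex.I))
    - ∫ t in Set.Iic c, F ((t : ℂ) + (φ₂ : ℂ) * Complex.I)

/-- Absolute convergence of the integral of `F` along the left loop of `leftLoopIntegral`. -/
def LeftLoopIntegrable (c φ₁ φ₂ : ℝ) (F : ℂ → ℂ) : Prop :=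
  MeasureTheory.IntegrableOn (fun t : ℝ => F ((t : ℂ) + (φ₁ : ℂ) * Complex.I)) (Set.Iic c) ∧
  IntervalIntegrable (fun t : ℝ => F ((c : ℂ) + (t : ℂ) * Complex.I))
    MeasureTheory.volume φ₁ φ₂ ∧
  MeasureTheory.IntegrableOn (fun t : ℝ => F ((t : ℂ) + (φ₂ : ℂ) * Complex.I)) (Set.Iic c)

/-- The left loop with parameters `c, φ₁, φ₂` has all the poles `-(aₖ + n) / Aₖ` (`n ∈ ℕ`) of the
numerator of the gamma ratio on its left, that is, inside (for `A > 0`). -/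
def IsAdmissibleLoop {p : ℕ} (A a : Fin p → ℝ) (c φ₁ φ₂ : ℝ) : Prop :=
  φ₁ < 0 ∧ 0 < φ₂ ∧ ∀ k, -(a k / A k) < c

/-- The integrand `s ↦ (∏ₖ Γ(Aₖ s + aₖ) / ∏ⱼ Γ(Bⱼ s + bⱼ)) x ^ (-s)`. -/
def integrand {p q : ℕ} (A a : Fin p → ℝ) (B b : Fin q → ℝ) (x : ℝ) (s : ℂ) : ℂ :=
  gammaRatio A a B b s * (x : ℂ) ^ (-s)

/-- Fox's function `H^{p,0}_{q,p}(x)` with upper parameters `(B, b)` and lower parameters `(A, a)`: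
the Mellin-Barnes integral over the left loop given by `c, φ₁, φ₂`. -/
def foxH {p q : ℕ} (A a : Fin p → ℝ) (B b : Fin q → ℝ) (c φ₁ φ₂ : ℝ) (x : ℝ) : ℂ :=
  1 / (2 * (Real.pi : ℂ) * Complex.I) * leftLoopIntegral c φ₁ φ₂ (integrand A a B b x)

/-- `ρ = ∏ₖ Aₖ ^ Aₖ ∏ⱼ Bⱼ ^ (-Bⱼ)`. -/
def rho {p q : ℕ} (A : Fin p → ℝ) (B : Fin q → ℝ) : ℝ :=
  (∏ k, (A k) ^ (A k)) * ∏ j, (B j) ^ (-(B j))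

/-- `μ = ∑ⱼ bⱼ - ∑ₖ aₖ + (p - q) / 2`. -/
def mu {p q : ℕ} (a : Fin p → ℝ) (b : Fin q → ℝ) : ℝ :=
  ∑ j, b j - ∑ k, a k + ((p : ℝ) - (q : ℝ)) / 2

/-- `ν = (2π) ^ ((p - q) / 2) ∏ₖ Aₖ ^ (aₖ - 1/2) ∏ⱼ Bⱼ ^ (1/2 - bⱼ)`. -/
def nu {p q : ℕ} (A a : Fin p → ℝ) (B b : Fin q → ℝ) : ℝ :=
  (2 * Real.pi) ^ (((p : ℝ) - (q : ℝ)) / 2) *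
    (∏ k, (A k) ^ (a k - 1 / 2)) * ∏ j, (B j) ^ (1 / 2 - b j)

/-- `Q(u) = ∑ᵢ u ^ (aᵢ / Aᵢ) / (1 - u ^ (1 / Aᵢ)) - ∑ⱼ u ^ (bⱼ / Bⱼ) / (1 - u ^ (1 / Bⱼ))`,
meant for `0 < u < 1`. -/
def Q {p q : ℕ} (A a : Fin p → ℝ) (B b : Fin q → ℝ) (u : ℝ) : ℝ :=
  (∑ i, u ^ (a i / A i) / (1 - u ^ (1 / A i))) - ∑ j, u ^ (b j / B j) / (1 - u ^ (1 / B j))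

end FoxH

end

open MeasureTheory Filter Topology Set
open scoped FourierTransform

/-! Write `G s` for `normRatio`, the gamma ratio times `rho ^ (-s)`, and put `t = log (rho / x)`.
The Mellin-Barnes integrand is then `G s * exp (t s)`, so `H` should be the inverse Laplace
transform of `G`, and the claimed identity is a Volterra equation for it in the variable `t`.

The equation comes from the logarithm of `G`. Binet's formula (`log_Gamma_add_eq`) writes each `log
Γ` as a Stirling term plus a Laplace integral. When the gamma factors are multiplied together, `Δ =
0` and `μ = 0` cancel the terms in `s log s`, `s` and `log s`, the factor `rho ^ (-s)` cancels the
remaining linear term, and the constants give `log ν`. Thus `G = ν exp (L k)` for large real `s`,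
where `L` is the Laplace transform and `t k(t) = Q (exp (-t))` (`normRatio_ofReal`, `mul_kern`).
Differentiating gives `G' = -G · L(t k)`. If `G = ν + L h`, this says `t h = ν t k + h ∗ (t k)`,
which is the required identity after the substitution `u = x exp v`.

The argument runs this backwards, so that no regularity of `H` has to be known beforehand. A
continuous `h` solving the Volterra equation is built by contraction (`exists_solution`); the
differential equation and the identity theorem give `G = ν + L h` on a right half-plane
(`exists_normRatio_eq`).

It remains to recover `h` from `G` on the loop. Since `G` tends to `ν` rather than to `0` far to the
right, direct inversion is not absolutely convergent. Instead `G / s ^ 2` is inverted on a vertical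
line, which gives the second antiderivative of `ν δ₀ + h`; the line is bent into the loop, where
`exp (t s)` decays, and the result is differentiated twice in `t` (`leftLoopIntegral_mul_exp`). The
bending needs `G` bounded away from the real axis (`exists_norm_normRatio_le`): on the right this is
`ν + L h`, on the left the reflection formula, and in between Phragmén–Lindelöf. -/

namespace FoxH

/-! ### Laplace transforms of functions of exponential order. -/

/-- Functions that are continuous on `(0, ∞)` and `O(exp (m t))` there. -/
structure ExpBounded (m : ℝ) (f : ℝ → ℝ) : Prop where
  cont : ContinuousOn f (Ioi 0)
  bound : ∃ C, ∀ t, 0 < t → |f t| ≤ C * Real.exp (m * t)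

/-- The Laplace transform at a complex point. -/
noncomputable def lap (f : ℝ → ℝ) (s : ℂ) : ℂ :=
  ∫ t in Ioi (0 : ℝ), (f t : ℂ) * Complex.exp (-s * t)

/-- The Laplace transform at a real point. -/
noncomputable def rlap (f : ℝ → ℝ) (x : ℝ) : ℝ :=
  ∫ t in Ioi (0 : ℝ), f t * Real.exp (-(x * t))

lemma lap_ofReal (f : ℝ → ℝ) (x : ℝ) : lap f x = (rlap f x : ℂ) := by
  rw [lap, rlap, ← integral_complex_ofReal]
  congr 1
  ext t
  push_cast
  ring_nf

lemma rlap_congr {f g : ℝ → ℝ} (h : ∀ t, 0 < t → f t = g t) (x : ℝ) : rlap f x = rlap g x :=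
  setIntegral_congr_fun measurableSet_Ioi fun t ht => by simp only [h t ht]

lemma integrableOn_exp_Ioi {b : ℝ} (hb : b < 0) :
    IntegrableOn (fun t : ℝ => Real.exp (b * t)) (Ioi 0) := by
  have := integrableOn_exp_mul_Ioi hb 0
  exact this

namespace ExpBounded

variable {m m' : ℝ} {f g : ℝ → ℝ}

lemma exists_nonneg (h : ExpBounded m f) :
    ∃ C, 0 ≤ C ∧ ∀ t, 0 < t → |f t| ≤ C * Real.exp (m * t) := by
  obtain ⟨C, hC⟩ := h.bound
  exact ⟨|C|, abs_nonneg _, fun t ht => (hC t ht).trans (by gcongr; exact le_abs_self C)⟩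

lemma mono (h : ExpBounded m f) (hm : m ≤ m') : ExpBounded m' f := by
  obtain ⟨C, hC0, hC⟩ := h.exists_nonneg
  exact ⟨h.cont, C, fun t ht => (hC t ht).trans (by gcongr)⟩

lemma add (hf : ExpBounded m f) (hg : ExpBounded m g) : ExpBounded m (fun t => f t + g t) := by
  obtain ⟨C, hC⟩ := hf.bound
  obtain ⟨D, hD⟩ := hg.bound
  refine ⟨hf.cont.add hg.cont, C + D, fun t ht => (abs_add_le _ _).trans ?_⟩
  rw [add_mul]
  exact add_le_add (hC t ht) (hD t ht)

lemma const_mul (c : ℝ) (hf : ExpBounded m f) : ExpBounded m (fun t => c * f t) := by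
  obtain ⟨C, hC⟩ := hf.bound
  refine ⟨continuousOn_const.mul hf.cont, |c| * C, fun t ht => ?_⟩
  rw [abs_mul, mul_assoc]
  exact mul_le_mul_of_nonneg_left (hC t ht) (abs_nonneg c)

lemma sub (hf : ExpBounded m f) (hg : ExpBounded m g) : ExpBounded m (fun t => f t - g t) := by
  have := hf.add (hg.const_mul (-1))
  simpa [sub_eq_add_neg] using this

lemma sum {ι : Type*} {S : Finset ι} {F : ι → ℝ → ℝ} (h : ∀ i ∈ S, ExpBounded m (F i)) :
    ExpBounded m (fun t => ∑ i ∈ S, F i t) := by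
  classical
  induction S using Finset.induction_on with
  | empty => exact ⟨by simpa using continuousOn_const, 0, fun t ht => by simp⟩
  | insert a S ha ih =>
    simp only [Finset.sum_insert ha]
    exact (h a (Finset.mem_insert_self a S)).add
      (ih fun i hi => h i (Finset.mem_insert_of_mem hi))

/-- A factor `t` costs an arbitrarily small amount of exponential order, because `(m' - m) t ≤ exp
((m' - m) t)`. This is why intermediate orders are chosen with `exists_between` later on. -/
lemma id_mul (hf : ExpBounded m f) (hm : m < m') : ExpBounded m' (fun t => t * f t) := by
  obtain ⟨C, hC0, hC⟩ := hf.exists_nonneg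
  refine ⟨continuousOn_id.mul hf.cont, C / (m' - m), fun t ht => ?_⟩
  have hd : 0 < m' - m := sub_pos.2 hm
  have h1 : (m' - m) * t ≤ Real.exp ((m' - m) * t) := by
    have := Real.add_one_le_exp ((m' - m) * t); linarith
  rw [abs_mul, abs_of_pos ht]
  calc t * |f t| ≤ t * (C * Real.exp (m * t)) := by gcongr; exact hC t ht
    _ = (C / (m' - m)) * (((m' - m) * t) * Real.exp (m * t)) := by field_simp
    _ ≤ (C / (m' - m)) * (Real.exp ((m' - m) * t) * Real.exp (m * t)) := by gcongr
    _ = _ := by rw [← Real.exp_add]; ring_nf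

lemma integrableOn_lap (hf : ExpBounded m f) {s : ℂ} (hs : m < s.re) :
    IntegrableOn (fun t : ℝ => (f t : ℂ) * Complex.exp (-s * t)) (Ioi 0) := by
  obtain ⟨C, hC⟩ := hf.bound
  have hi : IntegrableOn (fun t : ℝ => C * Real.exp ((m - s.re) * t)) (Ioi 0) :=
    (integrableOn_exp_Ioi (by linarith)).const_mul C
  refine Integrable.mono' hi ?_ ?_
  · refine ContinuousOn.aestronglyMeasurable ?_ measurableSet_Ioi
    exact (Complex.continuous_ofReal.comp_continuousOn hf.cont).mul (by fun_prop)
  · filter_upwards [ae_restrict_mem measurableSet_Ioi] with t ht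
    rw [norm_mul, Complex.norm_real, Complex.norm_exp, Real.norm_eq_abs]
    have : (-s * (t : ℂ)).re = -s.re * t := by simp
    rw [this]
    calc |f t| * Real.exp (-s.re * t) ≤ C * Real.exp (m * t) * Real.exp (-s.re * t) := by
          gcongr; exact hC t ht
      _ = _ := by rw [mul_assoc, ← Real.exp_add]; ring_nf

lemma integrableOn_rlap (hf : ExpBounded m f) {x : ℝ} (hx : m < x) :
    IntegrableOn (fun t : ℝ => f t * Real.exp (-(x * t))) (Ioi 0) := by
  have := (hf.integrableOn_lap (s := x) (by simpa using hx)).re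
  refine this.congr (ae_of_all _ fun t => ?_)
  have : (f t : ℂ) * Complex.exp (-(x : ℂ) * t) = ((f t * Real.exp (-(x * t)) : ℝ) : ℂ) := by
    push_cast; ring_nf
  simp only [this]
  exact Complex.ofReal_re _

lemma norm_lap_le (hf : ExpBounded m f) :
    ∃ C, 0 ≤ C ∧ ∀ s : ℂ, m < s.re → ‖lap f s‖ ≤ C / (s.re - m) := by
  obtain ⟨C, hC0, hC⟩ := hf.exists_nonneg
  refine ⟨C, hC0, fun s hs => ?_⟩
  have hi : IntegrableOn (fun t : ℝ => C * Real.exp ((m - s.re) * t)) (Ioi 0) :=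
    (integrableOn_exp_Ioi (by linarith)).const_mul C
  have h2 : ∫ t in Ioi (0 : ℝ), C * Real.exp ((m - s.re) * t) = C / (s.re - m) := by
    rw [integral_const_mul, integral_exp_mul_Ioi (by linarith)]
    have : m - s.re ≠ 0 := by linarith
    have : s.re - m ≠ 0 := by linarith
    simp only [mul_zero, Real.exp_zero]
    rw [show m - s.re = -(s.re - m) by ring, neg_div_neg_eq, mul_one_div]
  rw [← h2]
  refine norm_integral_le_of_norm_le hi ?_
  filter_upwards [ae_restrict_mem measurableSet_Ioi] with t ht
  rw [norm_mul, Complex.norm_real, Complex.norm_exp, Real.norm_eq_abs]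
  have : (-s * (t : ℂ)).re = -s.re * t := by simp
  rw [this]
  calc |f t| * Real.exp (-s.re * t) ≤ C * Real.exp (m * t) * Real.exp (-s.re * t) := by
        gcongr; exact hC t ht
    _ = _ := by rw [mul_assoc, ← Real.exp_add]; ring_nf

lemma tendsto_rlap (hf : ExpBounded m f) : Tendsto (rlap f) atTop (𝓝 0) := by
  obtain ⟨C, hC0, hC⟩ := hf.norm_lap_le
  have h : Tendsto (fun x : ℝ => C / (x - m)) atTop (𝓝 0) :=
    Tendsto.div_atTop tendsto_const_nhds (tendsto_atTop_add_const_right _ (-m) tendsto_id)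
  refine squeeze_zero_norm' ?_ h
  filter_upwards [eventually_gt_atTop m] with x hx
  have := hC x (by simpa using hx)
  rwa [lap_ofReal, Complex.norm_real, Complex.ofReal_re] at this

lemma hasDerivAt_lap (hf : ExpBounded m f) {s : ℂ} (hs : m < s.re) :
    HasDerivAt (lap f) (-lap (fun t => t * f t) s) s := by
  obtain ⟨m', hm, hm's⟩ := exists_between hs
  have hg := hf.id_mul hm
  obtain ⟨C, hC0, hC⟩ := hg.exists_nonneg
  obtain ⟨r, hr, hrs⟩ := exists_between hm's
  have hi : IntegrableOn (fun t : ℝ => C * Real.exp ((m' - r) * t)) (Ioi 0) :=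
    (integrableOn_exp_Ioi (by linarith)).const_mul C
  have hnhds : {z : ℂ | r < z.re} ∈ 𝓝 s :=
    (isOpen_lt continuous_const Complex.continuous_re).mem_nhds hrs
  have key := hasDerivAt_integral_of_dominated_loc_of_deriv_le (𝕜 := ℂ)
    (μ := volume.restrict (Ioi (0 : ℝ)))
    (F := fun (z : ℂ) (t : ℝ) => (f t : ℂ) * Complex.exp (-z * t))
    (F' := fun (z : ℂ) (t : ℝ) => (f t : ℂ) * (Complex.exp (-z * t) * (-(t : ℂ))))
    (bound := fun t : ℝ => C * Real.exp ((m' - r) * t))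
    (x₀ := s) hnhds ?_ (hf.integrableOn_lap hs) ?_ ?_ hi ?_
  · have h2 := key.2
    convert! h2 using 1
    rw [lap, ← integral_neg]
    congr 1
    ext t
    push_cast
    ring
  · filter_upwards [hnhds] with z hz
    exact (hf.integrableOn_lap (by linarith [show r < z.re from hz])).aestronglyMeasurable
  · refine ContinuousOn.aestronglyMeasurable ?_ measurableSet_Ioi
    exact (Complex.continuous_ofReal.comp_continuousOn hf.cont).mul (by fun_prop)
  · filter_upwards [ae_restrict_mem measurableSet_Ioi] with t ht z hz
    have ht : 0 < t := ht
    have hz : r < z.re := hz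
    have h1 : ‖(f t : ℂ) * (Complex.exp (-z * t) * (-(t : ℂ)))‖
        = |t * f t| * Real.exp (-z.re * t) := by
      rw [norm_mul, norm_mul, norm_neg, Complex.norm_real, Complex.norm_real, Complex.norm_exp,
        Real.norm_eq_abs, Real.norm_eq_abs, abs_mul]
      have : (-z * (t : ℂ)).re = -z.re * t := by simp
      rw [this]; ring
    rw [h1]
    calc |t * f t| * Real.exp (-z.re * t)
        ≤ C * Real.exp (m' * t) * Real.exp (-r * t) := by
          gcongr
          · exact hC t ht
      _ = _ := by rw [mul_assoc, ← Real.exp_add]; ring_nf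
  · refine ae_of_all _ fun t z _ => ?_
    refine HasDerivAt.const_mul _ ?_
    have := (((hasDerivAt_id z).neg.mul_const (t : ℂ))).cexp
    simpa using this

lemma hasDerivAt_rlap (hf : ExpBounded m f) {x : ℝ} (hx : m < x) :
    HasDerivAt (rlap f) (-rlap (fun t => t * f t) x) x := by
  have h := (hf.hasDerivAt_lap (s := x) (by simpa using hx)).real_of_complex
  have e1 : (fun x : ℝ => (lap f x).re) = rlap f := by
    ext y; rw [lap_ofReal, Complex.ofReal_re]
  rw [e1, lap_ofReal, ← Complex.ofReal_neg, Complex.ofReal_re] at h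
  exact h

lemma rlap_add (hf : ExpBounded m f) (hg : ExpBounded m g) {x : ℝ} (hx : m < x) :
    rlap (fun t => f t + g t) x = rlap f x + rlap g x := by
  rw [rlap, rlap, rlap, ← integral_add (hf.integrableOn_rlap hx) (hg.integrableOn_rlap hx)]
  simp only [add_mul]

lemma rlap_sub (hf : ExpBounded m f) (hg : ExpBounded m g) {x : ℝ} (hx : m < x) :
    rlap (fun t => f t - g t) x = rlap f x - rlap g x := by
  rw [rlap, rlap, rlap, ← integral_sub (hf.integrableOn_rlap hx) (hg.integrableOn_rlap hx)]
  simp only [sub_mul]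

lemma rlap_sum {ι : Type*} {S : Finset ι} {F : ι → ℝ → ℝ} (h : ∀ i ∈ S, ExpBounded m (F i))
    {x : ℝ} (hx : m < x) :
    rlap (fun t => ∑ i ∈ S, F i t) x = ∑ i ∈ S, rlap (F i) x := by
  simp only [rlap, Finset.sum_mul]
  exact integral_finsetSum _ fun i hi => (h i hi).integrableOn_rlap hx

end ExpBounded

lemma rlap_const_mul (c : ℝ) (f : ℝ → ℝ) (x : ℝ) :
    rlap (fun t => c * f t) x = c * rlap f x := by
  simp only [rlap, mul_assoc, integral_const_mul]

/-- The weight splits as `exp (-s t) = exp (-s w) exp (-s (t - w))`, so the weighted convolution is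
the convolution of the weighted functions, whose integral factors. -/
lemma ExpBounded.lap_convolution {m : ℝ} {f g : ℝ → ℝ} (hf : ExpBounded m f)
    (hg : ExpBounded m g) {s : ℂ} (hs : m < s.re) :
    lap (fun t => ∫ w in (0 : ℝ)..t, f w * g (t - w)) s = lap f s * lap g s := by
  have h := integral_posConvolution (hf.integrableOn_lap hs) (hg.integrableOn_lap hs)
    (ContinuousLinearMap.mul ℝ ℂ)
  simp only [ContinuousLinearMap.mul_apply'] at h
  rw [lap, lap, lap, ← h]
  congr 1
  ext t
  rw [← intervalIntegral.integral_ofReal, ← intervalIntegral.integral_mul_const]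
  congr 1
  ext w
  push_cast
  rw [show -s * (t : ℂ) = -s * w + -s * (t - w) by ring, Complex.exp_add]
  ring

lemma ExpBounded.rlap_convolution {m : ℝ} {f g : ℝ → ℝ} (hf : ExpBounded m f)
    (hg : ExpBounded m g) {x : ℝ} (hx : m < x) :
    rlap (fun t => ∫ w in (0 : ℝ)..t, f w * g (t - w)) x = rlap f x * rlap g x := by
  have := hf.lap_convolution hg (s := x) (by simpa using hx)
  rw [lap_ofReal, lap_ofReal, lap_ofReal] at this
  exact_mod_cast this

/-- Two functions on a ray with the same derivative and the same limit at infinity agree. -/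
lemma eq_of_hasDerivAt_of_tendsto {m l : ℝ} {F R D : ℝ → ℝ}
    (hF : ∀ x, m < x → HasDerivAt F (D x) x) (hR : ∀ x, m < x → HasDerivAt R (D x) x)
    (hF0 : Tendsto F atTop (𝓝 l)) (hR0 : Tendsto R atTop (𝓝 l)) {x : ℝ} (hx : m < x) :
    F x = R x := by
  have hd : ∀ y ∈ Ioi m, HasDerivAt (fun y => F y - R y) 0 y := fun y hy => by
    simpa using (hF y hy).fun_sub (hR y hy)
  have hc : ∀ y ∈ Ioi m, F y - R y = F x - R x := fun y hy =>
    (convex_Ioi m).is_const_of_fderivWithin_eq_zero (𝕜 := ℝ) (f := fun y => F y - R y)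
      (fun z hz => (hd z hz).differentiableAt.differentiableWithinAt)
      (fun z hz => by
        rw [fderivWithin_of_isOpen isOpen_Ioi hz]
        ext; simp [(hd z hz).hasFDerivAt.fderiv]) hy hx
  have h1 : Tendsto (fun y => F y - R y) atTop (𝓝 (F x - R x)) :=
    tendsto_const_nhds.congr' (by
      filter_upwards [eventually_gt_atTop m] with y hy using (hc y hy).symm)
  have h2 : Tendsto (fun y => F y - R y) atTop (𝓝 (l - l)) := hF0.sub hR0
  have := tendsto_nhds_unique h1 h2
  linarith

/-! ### Binet's formula. -/

lemma analyticAt_dslope_zero {f : ℝ → ℝ} (hf : ∀ x, AnalyticAt ℝ f x) (x : ℝ) :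
    AnalyticAt ℝ (dslope f 0) x := by
  rcases eq_or_ne x 0 with rfl | hx
  · obtain ⟨p, hp⟩ := hf 0
    exact ⟨_, hp.has_fpower_series_dslope_fslope⟩
  · have h1 : AnalyticAt ℝ (fun y => (f y - f 0) / y) x :=
      ((hf x).sub analyticAt_const).div analyticAt_id hx
    refine h1.congr ?_
    filter_upwards [isOpen_ne.mem_nhds hx] with y hy
    rw [dslope_of_ne _ hy, slope_def_field, sub_zero]

/-- The entire function `(exp u - 1) / u`. -/
noncomputable def expQuot : ℝ → ℝ := dslope Real.exp 0

lemma expQuot_of_ne {u : ℝ} (hu : u ≠ 0) : expQuot u = (Real.exp u - 1) / u := by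
  rw [expQuot, dslope_of_ne _ hu, slope_def_field, sub_zero, Real.exp_zero]

lemma expQuot_zero : expQuot 0 = 1 := by
  rw [expQuot, dslope_same, Real.deriv_exp, Real.exp_zero]

lemma expQuot_pos (u : ℝ) : 0 < expQuot u := by
  rcases lt_trichotomy u 0 with hu | rfl | hu
  · rw [expQuot_of_ne hu.ne]
    exact div_pos_of_neg_of_neg (by simpa using hu) hu
  · rw [expQuot_zero]; exact one_pos
  · rw [expQuot_of_ne hu.ne']
    exact div_pos (by simpa using hu) hu

lemma analyticAt_expQuot (u : ℝ) : AnalyticAt ℝ expQuot u :=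
  analyticAt_dslope_zero (fun _ => analyticAt_rexp) u

/-- The cubic Taylor remainder of `exp`, divided by `u`, is `O(u ^ 2)`. -/
lemma hasDerivAt_expQuot_zero : HasDerivAt expQuot (1 / 2) 0 := by
  rw [hasDerivAt_iff_isLittleO]
  have h : (fun u : ℝ => u * u) =o[𝓝 0] fun u : ℝ => u := by
    simpa using ((Asymptotics.isLittleO_one_iff ℝ).2 (tendsto_id (α := ℝ) (x := 𝓝 0))).mul_isBigO
      (Asymptotics.isBigO_refl (fun u : ℝ => u) (𝓝 0))
  simp only [sub_zero]
  refine Asymptotics.IsBigO.trans_isLittleO ?_ h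
  refine Asymptotics.IsBigO.of_bound 1 ?_
  have hnear : ∀ᶠ u : ℝ in 𝓝 0, |u| ≤ 1 := by
    filter_upwards [Metric.ball_mem_nhds (0 : ℝ) one_pos] with u hu
    rw [Metric.mem_ball, dist_zero_right, Real.norm_eq_abs] at hu
    exact hu.le
  filter_upwards [hnear] with u hu
  rcases eq_or_ne u 0 with rfl | hu0
  · simp
  · have h3 := Real.exp_bound hu (n := 3) (by norm_num)
    simp only [Finset.sum_range_succ, Finset.sum_range_zero] at h3
    norm_num at h3
    rw [expQuot_of_ne hu0, expQuot_zero]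
    have e : (Real.exp u - 1) / u - 1 - u • (1 / 2 : ℝ)
        = (Real.exp u - (1 + u + u ^ 2 / 2)) / u := by
      simp only [smul_eq_mul]
      field_simp
      ring
    rw [e, norm_div, Real.norm_eq_abs, Real.norm_eq_abs, div_le_iff₀ (abs_pos.2 hu0), norm_mul,
      Real.norm_eq_abs]
    calc |Real.exp u - (1 + u + u ^ 2 / 2)| ≤ |u| ^ 3 * (2 / 9) := h3
      _ ≤ 1 * (|u| * |u|) * |u| := by nlinarith [pow_nonneg (abs_nonneg u) 3]

/-- The analytic function `u exp (-a u) / (1 - exp (-u))`. -/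
noncomputable def bernoulliGen (a u : ℝ) : ℝ := Real.exp (-(a * u)) / expQuot (-u)

lemma bernoulliGen_of_ne (a : ℝ) {u : ℝ} (hu : u ≠ 0) :
    bernoulliGen a u = u * (Real.exp (-(a * u)) / (1 - Real.exp (-u))) := by
  have h : 1 - Real.exp (-u) ≠ 0 := by
    intro h
    have : Real.exp (-u) = 1 := by linarith
    rw [Real.exp_eq_one_iff] at this
    exact hu (by linarith)
  have h' : Real.exp (-u) - 1 ≠ 0 := fun h' => h (by linarith)
  rw [bernoulliGen, expQuot_of_ne (neg_ne_zero.2 hu)]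
  field_simp
  ring

lemma bernoulliGen_zero (a : ℝ) : bernoulliGen a 0 = 1 := by
  simp [bernoulliGen, expQuot_zero]

/-- Analyticity, rather than differentiability, is recorded because it survives `dslope`:
`binetKernel` divides out a zero at the origin twice and must still be continuous there. -/
lemma analyticAt_bernoulliGen (a u : ℝ) : AnalyticAt ℝ (bernoulliGen a) u := by
  refine AnalyticAt.div ?_ ?_ (expQuot_pos _).ne'
  · fun_prop
  · exact (analyticAt_expQuot (-u)).comp (analyticAt_id.neg)

lemma deriv_bernoulliGen (a : ℝ) : deriv (bernoulliGen a) 0 = 1 / 2 - a := by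
  have h1 : HasDerivAt (fun u : ℝ => Real.exp (-(a * u))) (-a) 0 := by
    have := ((hasDerivAt_id (0 : ℝ)).const_mul a).fun_neg.exp
    simpa using this
  have h2 : HasDerivAt (fun u : ℝ => expQuot (-u)) (-(1 / 2)) 0 := by
    have h := hasDerivAt_expQuot_zero
    rw [← neg_zero] at h
    have := h.comp (0 : ℝ) (hasDerivAt_id (0 : ℝ)).neg
    simpa [Function.comp_def] using this
  have h3 := h1.fun_div h2 (expQuot_pos _).ne'
  have h4 : HasDerivAt (bernoulliGen a) (1 / 2 - a) 0 := by
    refine h3.congr_deriv ?_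
    simp [expQuot_zero]
    ring
  exact h4.deriv

/-- The kernel of Binet's formula for `log Γ (z + a)`, continuously extended to the real line. -/
noncomputable def binetKernel (a : ℝ) : ℝ → ℝ := dslope (dslope (bernoulliGen a) 0) 0

lemma continuous_binetKernel (a : ℝ) : Continuous (binetKernel a) :=
  continuous_iff_continuousAt.2 fun x =>
    (analyticAt_dslope_zero (analyticAt_dslope_zero (analyticAt_bernoulliGen a)) x).continuousAt

lemma binetKernel_of_ne (a : ℝ) {u : ℝ} (hu : u ≠ 0) :
    binetKernel a u
      = (Real.exp (-(a * u)) / (1 - Real.exp (-u)) - 1 / u - (1 / 2 - a)) / u := by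
  rw [binetKernel, dslope_of_ne _ hu, slope_def_field, dslope_of_ne _ hu, slope_def_field,
    dslope_same, deriv_bernoulliGen, bernoulliGen_of_ne a hu, bernoulliGen_zero, sub_zero]
  field_simp

/-- Compactness handles `[0, 1]`, where the explicit formula is singular; for `t ≥ 1` each term is
elementary. The order is `|a|` because `exp (-(a t))` grows when `a < 0`. -/
lemma expBounded_binetKernel (a : ℝ) : ExpBounded |a| (binetKernel a) := by
  refine ⟨(continuous_binetKernel a).continuousOn, ?_⟩
  obtain ⟨B, hB⟩ := isCompact_Icc.exists_bound_of_continuousOn (s := Icc (0 : ℝ) 1)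
    (continuous_binetKernel a).continuousOn
  have hB0 : 0 ≤ B := (norm_nonneg _).trans (hB 0 (by simp))
  have he : 0 < 1 - Real.exp (-1) := by
    have : Real.exp (-1) < 1 := by simp
    linarith
  refine ⟨B + (1 / (1 - Real.exp (-1)) + 1 + |1 / 2 - a|), fun t ht => ?_⟩
  have h1 : 1 ≤ Real.exp (|a| * t) := Real.one_le_exp (by positivity)
  have hC : 0 ≤ 1 / (1 - Real.exp (-1)) + 1 + |1 / 2 - a| := by positivity
  rcases le_total t 1 with h | h
  · have := hB t ⟨ht.le, h⟩
    rw [Real.norm_eq_abs] at this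
    calc |binetKernel a t| ≤ B * 1 := by linarith
      _ ≤ (B + (1 / (1 - Real.exp (-1)) + 1 + |1 / 2 - a|)) * Real.exp (|a| * t) := by
        gcongr
        linarith
  · rw [binetKernel_of_ne a ht.ne', abs_div, abs_of_pos ht]
    have h2 : Real.exp (-t) ≤ Real.exp (-1) := Real.exp_le_exp.2 (by linarith)
    have h3 : |Real.exp (-(a * t)) / (1 - Real.exp (-t))|
        ≤ 1 / (1 - Real.exp (-1)) * Real.exp (|a| * t) := by
      rw [abs_div, abs_of_pos (Real.exp_pos _), abs_of_pos (by linarith), one_div,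
        ← div_eq_inv_mul]
      have : -(a * t) ≤ |a| * t := by nlinarith [neg_abs_le a]
      gcongr
    have h4 : |1 / t| ≤ 1 := by
      rw [abs_of_pos (by positivity), div_le_one ht]; exact h
    have h5 : |Real.exp (-(a * t)) / (1 - Real.exp (-t)) - 1 / t - (1 / 2 - a)|
        ≤ (1 / (1 - Real.exp (-1)) + 1 + |1 / 2 - a|) * Real.exp (|a| * t) := by
      refine (abs_sub _ _).trans ?_
      have := abs_sub (Real.exp (-(a * t)) / (1 - Real.exp (-t))) (1 / t)
      have h6 : |1 / 2 - a| ≤ |1 / 2 - a| * Real.exp (|a| * t) :=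
        le_mul_of_one_le_right (abs_nonneg _) h1
      rw [add_mul, add_mul, one_mul]
      linarith
    refine (div_le_self (abs_nonneg _) h).trans (h5.trans ?_)
    exact mul_le_mul_of_nonneg_right (by linarith) (Real.exp_pos _).le

lemma expBounded_exp_neg (c : ℝ) : ExpBounded (-c) (fun t => Real.exp (-(c * t))) :=
  ⟨by fun_prop, 1, fun t _ => by rw [abs_of_pos (Real.exp_pos _), one_mul]; simp⟩

lemma rlap_exp_neg {c x : ℝ} (h : 0 < x + c) :
    rlap (fun t => Real.exp (-(c * t))) x = 1 / (x + c) := by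
  have : ∀ t : ℝ, Real.exp (-(c * t)) * Real.exp (-(x * t)) = Real.exp (-(x + c) * t) :=
    fun t => by rw [← Real.exp_add]; ring_nf
  simp only [rlap, this]
  rw [integral_exp_mul_Ioi (by linarith)]
  simp only [mul_zero, Real.exp_zero]
  rw [neg_div_neg_eq]

lemma expBounded_expQuot_neg : ExpBounded 0 (fun t => expQuot (-t)) := by
  refine ⟨?_, 1, fun t ht => ?_⟩
  · have : Continuous expQuot :=
      continuous_iff_continuousAt.2 fun x => (analyticAt_expQuot x).continuousAt
    fun_prop
  · rw [abs_of_pos (expQuot_pos _), expQuot_of_ne (by linarith), zero_mul, Real.exp_zero, mul_one,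
      div_le_one_of_neg (by linarith)]
    have := Real.add_one_le_exp (-t)
    linarith

/-- Multiplying by `t` turns the function into `1 - exp (-t)`, so the derivatives of both sides
agree; both sides vanish at infinity. -/
lemma rlap_expQuot_neg {x : ℝ} (hx : 0 < x) :
    rlap (fun t => expQuot (-t)) x = Real.log (x + 1) - Real.log x := by
  have key : ∀ y, 0 < y → -rlap (fun t => t * expQuot (-t)) y = 1 / (y + 1) - 1 / y := by
    intro y hy
    have h1 : ∀ t, 0 < t →
        t * expQuot (-t) = Real.exp (-(0 * t)) - Real.exp (-(1 * t)) := by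
      intro t ht
      rw [expQuot_of_ne (by linarith)]
      simp
      field_simp
      ring
    rw [rlap_congr h1, ((expBounded_exp_neg 0).mono (m' := 0) (by simp)).rlap_sub
      ((expBounded_exp_neg 1).mono (m' := 0) (by simp)) hy, rlap_exp_neg (by linarith),
      rlap_exp_neg (by linarith)]
    ring
  refine eq_of_hasDerivAt_of_tendsto (m := 0) (l := 0)
    (fun y hy => expBounded_expQuot_neg.hasDerivAt_rlap hy) (fun y hy => ?_)
    expBounded_expQuot_neg.tendsto_rlap (Real.tendsto_log_comp_add_sub_log 1) hx
  rw [key y hy]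
  have h1 : HasDerivAt (fun y : ℝ => Real.log (y + 1)) (1 / (y + 1)) y :=
    ((hasDerivAt_id y).add_const 1).log (by simp only [id]; linarith)
  have h2 : HasDerivAt (fun y : ℝ => Real.log y) (1 / y) y := (hasDerivAt_id y).log hy.ne'
  exact h1.fun_sub h2

/-- The main term of Stirling's formula for `log Γ (z + a)`. -/
noncomputable def stirlingMain (a z : ℝ) : ℝ :=
  (z + a - 1 / 2) * Real.log z - z + 1 / 2 * Real.log (2 * Real.pi)

lemma tendsto_mul_log_add_sub_log (c : ℝ) :
    Tendsto (fun x : ℝ => x * (Real.log (x + c) - Real.log x)) atTop (𝓝 c) := by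
  refine (Real.tendsto_mul_log_one_add_div_atTop c).congr' ?_
  filter_upwards [eventually_gt_atTop 0, eventually_gt_atTop (-c)] with x hx hxc
  rw [← Real.log_div (by linarith) hx.ne']
  congr 2
  field_simp

/-- The functional equation of the Binet integral, matching `Γ (y + 1) = y Γ y`. The unit shift
multiplies the kernel by `1 - exp (-t)`, which cancels its denominator; a further factor `t`, that
is, a derivative in `z`, leaves elementary transforms. -/
lemma rlap_binetKernel_sub {a z : ℝ} (hz : |a| < z) :
    rlap (binetKernel a) z - rlap (binetKernel a) (z + 1)
      = -Real.log (z + a) + stirlingMain a (z + 1) - stirlingMain a z := by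
  set N : ℝ → ℝ := fun t => binetKernel a t * (1 - Real.exp (-t)) with hN
  have hNb : ExpBounded |a| N := by
    obtain ⟨C, hC0, hC⟩ := (expBounded_binetKernel a).exists_nonneg
    refine ⟨((continuous_binetKernel a).mul (by fun_prop)).continuousOn, C, fun t ht => ?_⟩
    have h1 : Real.exp (-t) ≤ 1 := Real.exp_le_one_iff.2 (by linarith)
    rw [hN, abs_mul, abs_of_nonneg (by linarith : (0 : ℝ) ≤ 1 - Real.exp (-t))]
    refine (mul_le_of_le_one_right (abs_nonneg _) ?_).trans (hC t ht)
    linarith [Real.exp_pos (-t)]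
  have hshift : ∀ y, |a| < y →
      rlap (binetKernel a) y - rlap (binetKernel a) (y + 1) = rlap N y := by
    intro y hy
    rw [rlap, rlap, rlap, ← integral_sub ((expBounded_binetKernel a).integrableOn_rlap hy)
      ((expBounded_binetKernel a).integrableOn_rlap (by linarith))]
    congr 1
    ext t
    rw [show -((y + 1) * t) = -t + -(y * t) by ring, Real.exp_add, hN]
    ring
  have ha := neg_abs_le a
  have ha0 := abs_nonneg a
  have key : ∀ y, |a| < y → -rlap (fun t => t * N t) y
      = -(1 / (y + a)) + (Real.log (y + 1) - Real.log y)
        + (1 / 2 - a) * (1 / y - 1 / (y + 1)) := by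
    intro y hy
    have h1 : ∀ t, 0 < t → t * N t = Real.exp (-(a * t)) -
        (expQuot (-t) + (1 / 2 - a) * (Real.exp (-(0 * t)) - Real.exp (-(1 * t)))) := by
      intro t ht
      have hne : 1 - Real.exp (-t) ≠ 0 := by
        have : Real.exp (-t) < 1 := by simpa using ht
        linarith
      rw [hN, expQuot_of_ne (by linarith)]
      simp only [binetKernel_of_ne a ht.ne', zero_mul, one_mul, neg_zero, Real.exp_zero]
      field_simp
      ring
    have b0 := (expBounded_exp_neg 0).mono (m' := |a|) (by simp)
    have b1 := (expBounded_exp_neg 1).mono (m' := |a|) (by linarith)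
    have ba := (expBounded_exp_neg a).mono (m' := |a|) (by linarith)
    have be := expBounded_expQuot_neg.mono ha0
    rw [rlap_congr h1, ba.rlap_sub (be.add ((b0.sub b1).const_mul _)) hy,
      be.rlap_add ((b0.sub b1).const_mul _) hy, rlap_const_mul, b0.rlap_sub b1 hy,
      rlap_exp_neg (by linarith), rlap_exp_neg (by linarith), rlap_exp_neg (by linarith),
      rlap_expQuot_neg (by linarith)]
    ring
  rw [hshift z hz]
  refine eq_of_hasDerivAt_of_tendsto (m := |a|) (l := 0) (F := rlap N)
    (R := fun z => -Real.log (z + a) + stirlingMain a (z + 1) - stirlingMain a z)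
    (fun y hy => hNb.hasDerivAt_rlap hy) (fun y hy => ?_)
    hNb.tendsto_rlap ?_ hz
  · rw [key y hy]
    have hy0 : 0 < y := by linarith
    have hya : 0 < y + a := by linarith
    have h1 : HasDerivAt (fun y : ℝ => Real.log (y + 1)) (1 / (y + 1)) y :=
      ((hasDerivAt_id y).add_const 1).log (by simp only [id]; linarith)
    have h2 : HasDerivAt (fun y : ℝ => Real.log y) (1 / y) y := (hasDerivAt_id y).log hy0.ne'
    have h3 : HasDerivAt (fun y : ℝ => Real.log (y + a)) (1 / (y + a)) y :=
      ((hasDerivAt_id y).add_const a).log (by simp only [id]; linarith)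
    have h4 : HasDerivAt (fun y : ℝ => y + 1 + a - 1 / 2) 1 y :=
      (((hasDerivAt_id y).add_const 1).add_const a).sub_const (1 / 2)
    have h5 : HasDerivAt (fun y : ℝ => y + a - 1 / 2) 1 y :=
      ((hasDerivAt_id y).add_const a).sub_const (1 / 2)
    have h6 := ((h4.fun_mul h1).fun_sub ((hasDerivAt_id y).add_const 1)).add_const
      (1 / 2 * Real.log (2 * Real.pi))
    have h7 := ((h5.fun_mul h2).fun_sub (hasDerivAt_id y)).add_const
      (1 / 2 * Real.log (2 * Real.pi))
    have h8 := (h3.fun_neg.fun_add h6).fun_sub h7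
    refine h8.congr_deriv ?_
    have : y + 1 ≠ 0 := by linarith
    field_simp
    ring
  -- The right-hand side tends to `0`: its only nonvanishing pieces are `x (log (x + 1) - log x) →
  -- 1` and the `-1` from the linear terms of `stirlingMain`.
  · have l1 := (Real.tendsto_log_comp_add_sub_log a).neg
    have l2 := (Real.tendsto_log_comp_add_sub_log 1).const_mul (a + 1 / 2)
    have l3 := tendsto_mul_log_add_sub_log 1
    have l4 := ((l1.add l2).add l3).sub_const 1
    have e0 : -0 + (a + 1 / 2) * 0 + 1 - (1 : ℝ) = 0 := by ring
    rw [e0] at l4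
    refine l4.congr fun x => ?_
    simp only [stirlingMain]
    ring

/-- Euler's limit for `log Γ` together with Stirling's formula for `n!`. The shift is `n + 1`
because Euler's sequence `logGammaSeq` contains the `n + 1` logarithms `log (z + a + m)`, `m ≤ n`.
-/
lemma tendsto_log_Gamma_sub_stirlingMain {a z : ℝ} (hz : |a| < z) :
    Tendsto (fun n : ℕ => Real.log (Real.Gamma (z + (n + 1 : ℕ) + a))
      - stirlingMain a (z + (n + 1 : ℕ))) atTop (𝓝 0) := by
  have hw : 0 < z + a := by linarith [neg_abs_le a]
  have h1 := Real.BohrMollerup.tendsto_log_gamma hw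
  have hfe : ∀ {y : ℝ}, 0 < y → (Real.log ∘ Real.Gamma) (y + 1)
      = (Real.log ∘ Real.Gamma) y + Real.log y := by
    intro y hy
    simp only [Function.comp_apply]
    rw [Real.Gamma_add_one hy.ne', Real.log_mul hy.ne' (Real.Gamma_pos_of_pos hy).ne', add_comm]
  have h2 : ∀ n : ℕ, Real.log (Real.Gamma (z + a + (n + 1 : ℕ)))
      = Real.log (Real.Gamma (z + a)) + ∑ m ∈ Finset.range (n + 1), Real.log (z + a + m) :=
    fun n => Real.BohrMollerup.f_add_nat_eq (f := Real.log ∘ Real.Gamma) hfe hw (n + 1)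
  have h3 : Tendsto (fun n => Real.log (Stirling.stirlingSeq n) - Real.log (√Real.pi)) atTop
      (𝓝 0) := by
    have h := (Real.continuousAt_log (Real.sqrt_pos.2 Real.pi_pos).ne').tendsto.comp
      Stirling.tendsto_stirlingSeq_sqrt_pi
    have := h.sub_const (Real.log (√Real.pi))
    rwa [sub_self] at this
  have h4 := (tendsto_mul_log_add_sub_log (z + 1)).comp (tendsto_natCast_atTop_atTop (R := ℝ))
  have h5 := ((Real.tendsto_log_comp_add_sub_log (z + 1)).comp
    (tendsto_natCast_atTop_atTop (R := ℝ))).const_mul (z + a + 1 / 2)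
  have h6 := (((h1.const_sub (Real.log (Real.Gamma (z + a)))).add h3).sub
    (h4.sub_const (z + 1))).sub h5
  have e0 : Real.log (Real.Gamma (z + a)) - Real.log (Real.Gamma (z + a)) + 0
      - (z + 1 - (z + 1)) - (z + a + 1 / 2) * 0 = 0 := by ring
  rw [e0] at h6
  refine h6.congr' ?_
  filter_upwards [eventually_gt_atTop 0] with n hn
  have hn' : (0 : ℝ) < n := by exact_mod_cast hn
  rw [show z + (n + 1 : ℕ) + a = z + a + (n + 1 : ℕ) by ring, h2 n,
    Stirling.log_stirlingSeq_formula, Real.BohrMollerup.logGammaSeq, stirlingMain,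
    Real.log_div hn'.ne' (Real.exp_pos 1).ne', Real.log_exp, Real.log_mul two_ne_zero hn'.ne',
    Real.log_mul two_ne_zero Real.pi_pos.ne', Real.log_sqrt Real.pi_pos.le]
  simp only [Function.comp_apply]
  push_cast
  rw [show z + ((n : ℝ) + 1) = n + (z + 1) by ring]
  ring

/-- **Binet's formula** for `log Γ (z + a)`. -/
theorem log_Gamma_add_eq {a z : ℝ} (hz : |a| < z) :
    Real.log (Real.Gamma (z + a)) = stirlingMain a z + rlap (binetKernel a) z := by
  -- The defect `w` has period one and tends to `0` along `z + n`, hence vanishes.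
  set w : ℝ → ℝ := fun z => Real.log (Real.Gamma (z + a)) - stirlingMain a z
    - rlap (binetKernel a) z with hw
  have h1 : ∀ y, |a| < y → w (y + 1) = w y := by
    intro y hy
    have hya : 0 < y + a := by linarith [neg_abs_le a]
    have h := rlap_binetKernel_sub hy
    simp only [hw]
    rw [show y + 1 + a = y + a + 1 by ring, Real.Gamma_add_one hya.ne',
      Real.log_mul hya.ne' (Real.Gamma_pos_of_pos hya).ne']
    linarith
  have h2 : ∀ n : ℕ, w (z + n) = w z := by
    intro n
    induction n with
    | zero => simp
    | succ n ih =>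
      rw [← ih, ← h1 (z + n) (by have : (0 : ℝ) ≤ n := n.cast_nonneg; linarith)]
      push_cast
      ring_nf
  have h3 : Tendsto (fun n : ℕ => w (z + (n + 1 : ℕ))) atTop (𝓝 (0 - 0)) := by
    refine (tendsto_log_Gamma_sub_stirlingMain hz).sub
      ((expBounded_binetKernel a).tendsto_rlap.comp ?_)
    exact tendsto_atTop_add_const_left _ _
      ((tendsto_natCast_atTop_atTop (R := ℝ)).comp (tendsto_add_atTop_nat 1))
  have h4 : w z = 0 := by
    rw [sub_zero] at h3
    refine tendsto_nhds_unique ?_ h3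
    refine tendsto_const_nhds.congr fun n => (h2 (n + 1)).symm
  simp only [hw] at h4
  linarith

/-! ### The logarithm of the gamma ratio as a Laplace integral. -/

variable {p q : ℕ}

/-- The kernel `Q (exp (-t)) / t`, continuously extended to the real line. -/
noncomputable def kern (A a : Fin p → ℝ) (B b : Fin q → ℝ) (t : ℝ) : ℝ :=
  ∑ k, 1 / A k * binetKernel (a k) (t / A k) - ∑ j, 1 / B j * binetKernel (b j) (t / B j)

lemma continuous_kern (A a : Fin p → ℝ) (B b : Fin q → ℝ) : Continuous (kern A a B b) := by
  refine Continuous.sub ?_ ?_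
  · exact continuous_finsetSum _ fun k _ => continuous_const.mul
      ((continuous_binetKernel (a k)).comp (continuous_id.div_const _))
  · exact continuous_finsetSum _ fun k _ => continuous_const.mul
      ((continuous_binetKernel (b k)).comp (continuous_id.div_const _))

/-- Each Binet kernel contributes a term of `Q` minus `c / t` and `1 / 2 - d`. The first corrections
add up to a multiple of `Δ`, the second to a multiple of `μ`. -/
lemma mul_kern {A a : Fin p → ℝ} {B b : Fin q → ℝ} (hA : ∀ k, 0 < A k) (hB : ∀ j, 0 < B j)
    (hmu : mu a b = 0) (hDelta : ∑ j, B j - ∑ k, A k = 0) {t : ℝ} (ht : 0 < t) :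
    t * kern A a B b t = Q A a B b (Real.exp (-t)) := by
  have h : ∀ c d : ℝ, 0 < c → t * (1 / c * binetKernel d (t / c)) =
      Real.exp (-t) ^ (d / c) / (1 - Real.exp (-t) ^ (1 / c)) - c / t - (1 / 2 - d) := by
    intro c d hc
    have htc : t / c ≠ 0 := (div_pos ht hc).ne'
    rw [binetKernel_of_ne d htc, ← Real.exp_mul, ← Real.exp_mul,
      show -t * (d / c) = -(d * (t / c)) by ring, show -t * (1 / c) = -(t / c) by ring]
    field_simp
  have e1 : ∑ k, t * (1 / A k * binetKernel (a k) (t / A k)) =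
      ∑ k, Real.exp (-t) ^ (a k / A k) / (1 - Real.exp (-t) ^ (1 / A k))
        - (∑ k, A k) / t - (p * (1 / 2) - ∑ k, a k) := by
    rw [Finset.sum_congr rfl fun k _ => h (A k) (a k) (hA k), Finset.sum_sub_distrib,
      Finset.sum_sub_distrib, Finset.sum_sub_distrib, Finset.sum_div]
    simp
  have e2 : ∑ j, t * (1 / B j * binetKernel (b j) (t / B j)) =
      ∑ j, Real.exp (-t) ^ (b j / B j) / (1 - Real.exp (-t) ^ (1 / B j))
        - (∑ j, B j) / t - (q * (1 / 2) - ∑ j, b j) := by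
    rw [Finset.sum_congr rfl fun k _ => h (B k) (b k) (hB k), Finset.sum_sub_distrib,
      Finset.sum_sub_distrib, Finset.sum_sub_distrib, Finset.sum_div]
    simp
  rw [kern, mul_sub, Finset.mul_sum, Finset.mul_sum, e1, e2, Q]
  have e3 : ∑ j, B j = ∑ k, A k := by linarith
  rw [e3]
  unfold mu at hmu
  linarith

lemma expBounded_binetKernel_scaled {A : ℝ} (hA : 0 < A) (a : ℝ) :
    ExpBounded (|a| / A) (fun t => 1 / A * binetKernel a (t / A)) := by
  refine ExpBounded.const_mul _ ⟨?_, ?_⟩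
  · exact ((continuous_binetKernel a).comp (continuous_id.div_const _)).continuousOn
  · obtain ⟨C, hC⟩ := (expBounded_binetKernel a).bound
    refine ⟨C, fun t ht => (hC _ (div_pos ht hA)).trans_eq ?_⟩
    ring_nf

lemma rlap_binetKernel_scaled {A : ℝ} (hA : 0 < A) (a s : ℝ) :
    rlap (fun t => 1 / A * binetKernel a (t / A)) s = rlap (binetKernel a) (A * s) := by
  rw [rlap_const_mul, rlap, rlap]
  have h := integral_comp_mul_left_Ioi
    (fun u => binetKernel a u * Real.exp (-(A * s * u))) 0 (inv_pos.2 hA)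
  simp only [mul_zero, inv_inv, smul_eq_mul] at h
  have e : ∀ t : ℝ, binetKernel a (t / A) * Real.exp (-(s * t))
      = binetKernel a (A⁻¹ * t) * Real.exp (-(A * s * (A⁻¹ * t))) := by
    intro t
    rw [div_eq_inv_mul]
    congr 3
    field_simp
  simp only [e, h]
  field_simp

/-- A common order of growth of the kernels. -/
noncomputable def kernOrder (A a : Fin p → ℝ) (B b : Fin q → ℝ) : ℝ :=
  ∑ k, |a k| / A k + ∑ j, |b j| / B j

lemma kernOrder_nonneg {A a : Fin p → ℝ} {B b : Fin q → ℝ} (hA : ∀ k, 0 < A k)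
    (hB : ∀ j, 0 < B j) : 0 ≤ kernOrder A a B b :=
  add_nonneg (Finset.sum_nonneg fun k _ => div_nonneg (abs_nonneg _) (hA k).le)
    (Finset.sum_nonneg fun k _ => div_nonneg (abs_nonneg _) (hB k).le)

lemma le_kernOrder_left {A a : Fin p → ℝ} {B b : Fin q → ℝ} (hA : ∀ k, 0 < A k)
    (hB : ∀ j, 0 < B j) (k : Fin p) : |a k| / A k ≤ kernOrder A a B b := by
  have h1 := Finset.single_le_sum (f := fun k => |a k| / A k)
    (fun k _ => div_nonneg (abs_nonneg _) (hA k).le) (Finset.mem_univ k)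
  have h2 : 0 ≤ ∑ j, |b j| / B j :=
    Finset.sum_nonneg fun k _ => div_nonneg (abs_nonneg _) (hB k).le
  unfold kernOrder
  linarith

lemma le_kernOrder_right {A a : Fin p → ℝ} {B b : Fin q → ℝ} (hA : ∀ k, 0 < A k)
    (hB : ∀ j, 0 < B j) (j : Fin q) : |b j| / B j ≤ kernOrder A a B b := by
  have h1 := Finset.single_le_sum (f := fun k => |b k| / B k)
    (fun k _ => div_nonneg (abs_nonneg _) (hB k).le) (Finset.mem_univ j)
  have h2 : 0 ≤ ∑ j, |a j| / A j :=
    Finset.sum_nonneg fun k _ => div_nonneg (abs_nonneg _) (hA k).le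
  unfold kernOrder
  linarith

lemma expBounded_kern {A a : Fin p → ℝ} {B b : Fin q → ℝ} (hA : ∀ k, 0 < A k)
    (hB : ∀ j, 0 < B j) : ExpBounded (kernOrder A a B b) (kern A a B b) :=
  (ExpBounded.sum fun k _ => (expBounded_binetKernel_scaled (hA k) (a k)).mono
    (le_kernOrder_left hA hB k)).sub
  (ExpBounded.sum fun j _ => (expBounded_binetKernel_scaled (hB j) (b j)).mono
    (le_kernOrder_right hA hB j))

lemma rlap_kern {A a : Fin p → ℝ} {B b : Fin q → ℝ} (hA : ∀ k, 0 < A k)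
    (hB : ∀ j, 0 < B j) {s : ℝ} (hs : kernOrder A a B b < s) :
    rlap (kern A a B b) s = ∑ k, rlap (binetKernel (a k)) (A k * s)
      - ∑ j, rlap (binetKernel (b j)) (B j * s) := by
  have h1 : ∀ k ∈ Finset.univ, ExpBounded (kernOrder A a B b)
      (fun t => 1 / A k * binetKernel (a k) (t / A k)) := fun k _ =>
    (expBounded_binetKernel_scaled (hA k) (a k)).mono (le_kernOrder_left hA hB k)
  have h2 : ∀ k ∈ Finset.univ, ExpBounded (kernOrder A a B b)
      (fun t => 1 / B k * binetKernel (b k) (t / B k)) := fun k _ =>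
    (expBounded_binetKernel_scaled (hB k) (b k)).mono (le_kernOrder_right hA hB k)
  have h3 := (ExpBounded.sum h1).rlap_sub (ExpBounded.sum h2) hs
  rw [ExpBounded.rlap_sum h1 hs, ExpBounded.rlap_sum h2 hs] at h3
  simp only [fun k => rlap_binetKernel_scaled (hA k) (a k) s,
    fun k => rlap_binetKernel_scaled (hB k) (b k) s] at h3
  exact h3

lemma rho_eq_exp {A : Fin p → ℝ} {B : Fin q → ℝ} (hA : ∀ k, 0 < A k) (hB : ∀ j, 0 < B j) :
    rho A B = Real.exp (∑ k, A k * Real.log (A k) - ∑ j, B j * Real.log (B j)) := by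
  rw [rho, sub_eq_add_neg, Real.exp_add, ← Finset.sum_neg_distrib, Real.exp_sum, Real.exp_sum]
  congr 1
  · exact Finset.prod_congr rfl fun k _ => by rw [Real.rpow_def_of_pos (hA k), mul_comm]
  · exact Finset.prod_congr rfl fun k _ => by rw [Real.rpow_def_of_pos (hB k)]; ring_nf

lemma rho_pos {A : Fin p → ℝ} {B : Fin q → ℝ} (hA : ∀ k, 0 < A k) (hB : ∀ j, 0 < B j) :
    0 < rho A B := by
  rw [rho_eq_exp hA hB]; exact Real.exp_pos _

lemma nu_eq_exp {A a : Fin p → ℝ} {B b : Fin q → ℝ} (hA : ∀ k, 0 < A k) (hB : ∀ j, 0 < B j) :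
    nu A a B b = Real.exp (((p : ℝ) - q) / 2 * Real.log (2 * Real.pi)
      + ∑ k, (a k - 1 / 2) * Real.log (A k) + ∑ j, (1 / 2 - b j) * Real.log (B j)) := by
  rw [nu, Real.exp_add, Real.exp_add, Real.exp_sum, Real.exp_sum]
  congr 1
  · congr 1
    · rw [Real.rpow_def_of_pos (by positivity), mul_comm]
    · exact Finset.prod_congr rfl fun k _ => by rw [Real.rpow_def_of_pos (hA k), mul_comm]
  · exact Finset.prod_congr rfl fun k _ => by rw [Real.rpow_def_of_pos (hB k), mul_comm]

lemma prod_Gamma_eq_exp {n : ℕ} {A a : Fin n → ℝ} (hA : ∀ k, 0 < A k) {s : ℝ} (hs0 : 0 < s)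
    (hs : ∀ k, |a k| < A k * s) :
    ∏ k, Real.Gamma (A k * s + a k) = Real.exp (
      s * ∑ k, A k * Real.log (A k) + ∑ k, (a k - 1 / 2) * Real.log (A k)
      + (s * ∑ k, A k + ∑ k, a k - n / 2) * Real.log s - s * ∑ k, A k
      + n * (1 / 2 * Real.log (2 * Real.pi))
      + ∑ k, rlap (binetKernel (a k)) (A k * s)) := by
  have h : ∀ k, Real.Gamma (A k * s + a k) = Real.exp (
      s * (A k * Real.log (A k)) + (a k - 1 / 2) * Real.log (A k)
      + (s * A k + a k - 1 / 2) * Real.log s - s * A k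
      + 1 / 2 * Real.log (2 * Real.pi) + rlap (binetKernel (a k)) (A k * s)) := by
    intro k
    have hpos : 0 < A k * s + a k := by linarith [neg_abs_le (a k), hs k]
    rw [← Real.exp_log (Real.Gamma_pos_of_pos hpos), log_Gamma_add_eq (hs k), stirlingMain,
      Real.log_mul (hA k).ne' hs0.ne']
    ring_nf
  rw [Finset.prod_congr rfl fun k _ => h k, ← Real.exp_sum]
  congr 1
  simp only [Finset.sum_add_distrib, Finset.sum_sub_distrib, ← Finset.mul_sum, ← Finset.sum_mul]
  simp
  ring

/-- The gamma ratio normalised by `rho ^ (-s)`. -/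
noncomputable def normRatio (A a : Fin p → ℝ) (B b : Fin q → ℝ) (s : ℂ) : ℂ :=
  gammaRatio A a B b s * (rho A B : ℂ) ^ (-s)

lemma normRatio_ofReal {A a : Fin p → ℝ} {B b : Fin q → ℝ} (hA : ∀ k, 0 < A k)
    (hB : ∀ j, 0 < B j) (hmu : mu a b = 0) (hDelta : ∑ j, B j - ∑ k, A k = 0)
    {s : ℝ} (hs : kernOrder A a B b < s) :
    normRatio A a B b s = ((nu A a B b * Real.exp (rlap (kern A a B b) s) : ℝ) : ℂ) := by
  have hs0 : 0 < s := (kernOrder_nonneg hA hB).trans_lt hs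
  have ha : ∀ k, |a k| < A k * s := fun k => by
    have := (le_kernOrder_left (a := a) (b := b) hA hB k).trans_lt hs
    rwa [div_lt_iff₀' (hA k)] at this
  have hb : ∀ k, |b k| < B k * s := fun k => by
    have := (le_kernOrder_right (a := a) (b := b) hA hB k).trans_lt hs
    rwa [div_lt_iff₀' (hB k)] at this
  have h1 : normRatio A a B b s = (((∏ k, Real.Gamma (A k * s + a k)) /
      (∏ j, Real.Gamma (B j * s + b j)) * rho A B ^ (-s) : ℝ) : ℂ) := by
    rw [normRatio, gammaRatio, ← Complex.ofReal_neg s,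
      ← Complex.ofReal_cpow (rho_pos hA hB).le]
    push_cast [← Complex.Gamma_ofReal]
    rfl
  rw [h1, prod_Gamma_eq_exp hA hs0 ha, prod_Gamma_eq_exp hB hs0 hb,
    Real.rpow_def_of_pos (rho_pos hA hB), rho_eq_exp hA hB, Real.log_exp, nu_eq_exp hA hB,
    rlap_kern hA hB hs, ← Real.exp_sub, ← Real.exp_add, ← Real.exp_add]
  congr 2
  have e3 : ∑ j, B j = ∑ k, A k := by linarith
  have e4 : ∑ j, (1 / 2 - b j) * Real.log (B j) = -∑ j, (b j - 1 / 2) * Real.log (B j) := by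
    rw [← Finset.sum_neg_distrib]
    exact Finset.sum_congr rfl fun k _ => by ring
  rw [e3, e4]
  unfold mu at hmu
  -- Once `Δ = 0` is inserted, `μ` is the coefficient left in front of `log s`.
  linear_combination (-(Real.log s)) * hmu

/-! ### The Volterra equation and its Laplace transform. -/

/-- The convolution equation divided by `t`, with `w = t θ`: the integral is over a fixed interval
and nothing is singular at `t = 0`. The bound `|v| |κ v| ≤ 1 / 2` makes the map a contraction of the
bounded continuous functions. -/
lemma exists_volterra {κ : ℝ → ℝ} {K : ℝ} (hc : Continuous κ) (hK : ∀ t, |κ t| ≤ K)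
    (hq : ∀ v, |v| * |κ v| ≤ 1 / 2) (ν : ℝ) :
    ∃ y : BoundedContinuousFunction ℝ ℝ, ∀ t,
      y t = ν * κ t + ∫ θ in (0 : ℝ)..1, y (t * θ) * (|t| * (1 - θ) * κ (t * (1 - θ))) := by
  have hker : ∀ t : ℝ, ∀ θ ∈ uIoc (0 : ℝ) 1, |(|t| * (1 - θ) * κ (t * (1 - θ)))| ≤ 1 / 2 := by
    intro t θ hθ
    rw [uIoc_of_le zero_le_one] at hθ
    have h1 : |t| * (1 - θ) = |t * (1 - θ)| := by
      rw [abs_mul, abs_of_nonneg (by linarith [hθ.2] : 0 ≤ 1 - θ)]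
    rw [h1, abs_mul, abs_abs]
    exact hq _
  have hcont : ∀ y : BoundedContinuousFunction ℝ ℝ, Continuous fun t : ℝ =>
      ν * κ t + ∫ θ in (0 : ℝ)..1, y (t * θ) * (|t| * (1 - θ) * κ (t * (1 - θ))) := by
    intro y
    refine (continuous_const.mul hc).add ?_
    refine intervalIntegral.continuous_parametric_intervalIntegral_of_continuous' ?_ 0 1
    have := y.continuous
    fun_prop
  have hbd : ∀ y : BoundedContinuousFunction ℝ ℝ, ∀ t : ℝ,
      ‖∫ θ in (0 : ℝ)..1, y (t * θ) * (|t| * (1 - θ) * κ (t * (1 - θ)))‖ ≤ 1 / 2 * ‖y‖ := by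
    intro y t
    have := intervalIntegral.norm_integral_le_of_norm_le_const (a := (0 : ℝ)) (b := 1)
      (C := 1 / 2 * ‖y‖) (f := fun θ => y (t * θ) * (|t| * (1 - θ) * κ (t * (1 - θ)))) ?_
    · simpa using this
    · intro θ hθ
      rw [norm_mul, mul_comm]
      exact mul_le_mul (hker t θ hθ) (y.norm_coe_le_norm _) (norm_nonneg _) (by norm_num)
  set T : BoundedContinuousFunction ℝ ℝ → BoundedContinuousFunction ℝ ℝ := fun y =>
    BoundedContinuousFunction.ofNormedAddCommGroup _ (hcont y) (|ν| * K + 1 / 2 * ‖y‖) (by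
      intro t
      refine (norm_add_le _ _).trans (add_le_add ?_ (hbd y t))
      rw [norm_mul]
      exact mul_le_mul_of_nonneg_left (hK t) (abs_nonneg ν)) with hT
  have hTapp : ∀ y t, T y t =
      ν * κ t + ∫ θ in (0 : ℝ)..1, y (t * θ) * (|t| * (1 - θ) * κ (t * (1 - θ))) :=
    fun y t => rfl
  have hcontr : ContractingWith (1 / 2) T := by
    refine ⟨by norm_num, LipschitzWith.of_dist_le_mul fun y z => ?_⟩
    rw [BoundedContinuousFunction.dist_le (by positivity)]
    intro t
    have hi : ∀ w : BoundedContinuousFunction ℝ ℝ, IntervalIntegrable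
        (fun θ => w (t * θ) * (|t| * (1 - θ) * κ (t * (1 - θ)))) volume 0 1 := by
      intro w
      refine Continuous.intervalIntegrable ?_ _ _
      have := w.continuous
      fun_prop
    have := hbd (y - z) t
    rw [Real.dist_eq, hTapp, hTapp, add_sub_add_left_eq_sub,
      ← intervalIntegral.integral_sub (hi y) (hi z), dist_eq_norm]
    simp only [BoundedContinuousFunction.coe_sub, Pi.sub_apply, sub_mul] at this
    simpa using this
  refine ⟨ContractingWith.fixedPoint T hcontr, fun t => ?_⟩
  have h := hcontr.fixedPoint_isFixedPt
  conv_lhs => rw [← h]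
  exact hTapp _ t

lemma exists_solution {k : ℝ → ℝ} {m : ℝ} (hk : Continuous k) (hkm : ExpBounded m k) (ν : ℝ) :
    ∃ σ, m < σ ∧ ∃ h : ℝ → ℝ, Continuous h ∧ ExpBounded σ h ∧
      ∀ t, 0 < t → t * h t = ν * (t * k t) + ∫ w in (0 : ℝ)..t, h w * ((t - w) * k (t - w)) := by
  obtain ⟨C, hC0, hC⟩ := hkm.exists_nonneg
  -- Weighting by `exp (-σ t)` makes the kernel small: `|v| |κ v|` is at most `C |v| exp (-(2 C + 1)
  -- |v|)`, which is below `1 / 2`. The absolute values extend the weighted kernel evenly to the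
  -- whole line.
  set σ := m + 2 * C + 1 with hσ
  set κ : ℝ → ℝ := fun v => k |v| * Real.exp (-σ * |v|) with hκ
  have hκc : Continuous κ := by rw [hκ]; fun_prop
  have hκb : ∀ v : ℝ, v ≠ 0 → |κ v| ≤ C * Real.exp (-(2 * C + 1) * |v|) := by
    intro v hv
    rw [hκ, abs_mul, abs_of_pos (Real.exp_pos _)]
    calc |k (abs v)| * Real.exp (-σ * |v|) ≤ C * Real.exp (m * |v|) * Real.exp (-σ * |v|) := by
          gcongr; exact hC _ (abs_pos.2 hv)
      _ = _ := by rw [mul_assoc, ← Real.exp_add, hσ]; ring_nf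
  obtain ⟨y, hy⟩ := exists_volterra (κ := κ) (K := C + |κ 0|) hκc (by
    intro v
    rcases eq_or_ne v 0 with rfl | hv
    · linarith
    · refine (hκb v hv).trans ?_
      have : Real.exp (-(2 * C + 1) * |v|) ≤ 1 := Real.exp_le_one_iff.2 (by
        have := abs_nonneg v
        nlinarith)
      nlinarith [abs_nonneg (κ 0)]) (by
    intro v
    rcases eq_or_ne v 0 with rfl | hv
    · simp
    · have h1 := hκb v hv
      have h2 := Real.add_one_le_exp ((2 * C + 1) * |v|)
      have h3 : Real.exp (-(2 * C + 1) * |v|) * Real.exp ((2 * C + 1) * |v|) = 1 := by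
        rw [← Real.exp_add, ← Real.exp_zero]; ring_nf
      have h4 := Real.exp_pos (-(2 * C + 1) * |v|)
      have hv := abs_nonneg v
      calc |v| * |κ v| ≤ (abs v) * (C * Real.exp (-(2 * C + 1) * (abs v))) := by gcongr
        _ = 1 / 2 * ((2 * C * (abs v)) * Real.exp (-(2 * C + 1) * |v|)) := by ring
        _ ≤ 1 / 2 * (Real.exp ((2 * C + 1) * |v|) * Real.exp (-(2 * C + 1) * |v|)) := by
          gcongr; linarith
        _ = 1 / 2 := by rw [mul_comm (Real.exp _), h3]; norm_num) ν
  refine ⟨σ, by linarith, fun t => Real.exp (σ * t) * y t, ?_, ⟨?_, ‖y‖, fun t _ => ?_⟩, ?_⟩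
  · have := y.continuous
    fun_prop
  · have := y.continuous
    fun_prop
  · rw [abs_mul, abs_of_pos (Real.exp_pos _), mul_comm]
    gcongr
    exact y.norm_coe_le_norm t
  · intro t ht
    have h1 := hy t
    have h2 : t * ∫ θ in (0 : ℝ)..1, y (t * θ) * (|t| * (1 - θ) * κ (t * (1 - θ)))
        = ∫ w in (0 : ℝ)..t, y w * ((t - w) * κ (t - w)) := by
      have := intervalIntegral.smul_integral_comp_mul_left (a := 0) (b := 1)
        (fun w => y w * ((t - w) * κ (t - w))) t
      simp only [smul_eq_mul, mul_zero, mul_one] at this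
      rw [← this]
      congr 2
      ext θ
      rw [abs_of_pos ht]
      ring_nf
    have h3 : Real.exp (σ * t) * ∫ w in (0 : ℝ)..t, y w * ((t - w) * κ (t - w))
        = ∫ w in (0 : ℝ)..t, (Real.exp (σ * w) * y w) * ((t - w) * k (t - w)) := by
      rw [← intervalIntegral.integral_const_mul]
      refine intervalIntegral.integral_congr fun w hw => ?_
      rw [uIcc_of_le ht.le] at hw
      simp only [hκ]
      rw [abs_of_nonneg (by linarith [hw.2] : 0 ≤ t - w),
        show σ * t = σ * w + σ * (t - w) by ring, Real.exp_add]
      have : Real.exp (σ * (t - w)) * Real.exp (-σ * (t - w)) = 1 := by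
        rw [← Real.exp_add]; simp
      linear_combination Real.exp (σ * w) * y w * ((t - w) * k (t - w)) * this
    rw [← h3, ← h2]
    have h4 : Real.exp (σ * t) * κ t = k t := by
      simp only [hκ]
      rw [abs_of_pos ht, mul_comm, mul_assoc, ← Real.exp_add]
      simp
    rw [← h4]
    linear_combination (t * Real.exp (σ * t)) * h1

/-- In transforms the Volterra equation reads `F' = F · (L k)'` for `F = ν + L h`. Hence `F exp (-L
k)` is constant, and its limit at infinity is `ν`. -/
lemma add_rlap_solution {k h : ℝ → ℝ} {m σ ν : ℝ} (hkm : ExpBounded m k) (hσ : m < σ)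
    (hh : ExpBounded σ h)
    (heq : ∀ t, 0 < t →
      t * h t = ν * (t * k t) + ∫ w in (0 : ℝ)..t, h w * ((t - w) * k (t - w)))
    {x : ℝ} (hx : σ < x) : ν + rlap h x = ν * Real.exp (rlap k x) := by
  have htk : ExpBounded σ (fun t => t * k t) := hkm.id_mul hσ
  have hlap : ∀ y, σ < y → rlap (fun t => t * h t) y
      = (ν + rlap h y) * rlap (fun t => t * k t) y := by
    intro y hy
    obtain ⟨σ', h1, h2⟩ := exists_between hy
    have hc := hh.rlap_convolution htk hy
    have hs := (hh.id_mul h1).rlap_sub ((htk.mono h1.le).const_mul ν) h2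
    rw [rlap_const_mul] at hs
    rw [rlap_congr (g := fun t => t * h t - ν * (t * k t))
      (fun t ht => by linarith [heq t ht]), hs] at hc
    linarith
  have key := eq_of_hasDerivAt_of_tendsto (m := σ) (l := ν)
    (F := fun y => (ν + rlap h y) * Real.exp (-rlap k y)) (R := fun _ => ν) (D := fun _ => 0)
    (fun y hy => ?_) (fun y _ => hasDerivAt_const y ν) ?_ tendsto_const_nhds hx
  · beta_reduce at key
    rw [Real.exp_neg, ← div_eq_mul_inv, div_eq_iff (Real.exp_pos _).ne'] at key
    exact key
  · have d1 := (hh.hasDerivAt_rlap hy).const_add ν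
    have d2 := (hkm.hasDerivAt_rlap (hσ.trans hy)).fun_neg.exp
    refine (d1.fun_mul d2).congr_deriv ?_
    rw [hlap y hy]
    ring
  · have := (hh.tendsto_rlap.const_add ν).mul
      ((Real.continuous_exp.tendsto _).comp hkm.tendsto_rlap.neg)
    simpa using this

/-! ### Holomorphy of the gamma ratio and its continuation as a Laplace transform. -/

/-- Only the numerator can create poles, since `1 / Γ` is entire. -/
lemma differentiableAt_gammaRatio {A a : Fin p → ℝ} {B b : Fin q → ℝ} {s : ℂ}
    (h : ∀ k, ∀ n : ℕ, (A k : ℂ) * s + a k ≠ -n) :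
    DifferentiableAt ℂ (gammaRatio A a B b) s := by
  have e : gammaRatio A a B b = fun s => (∏ k, Complex.Gamma ((A k : ℂ) * s + (a k : ℂ))) *
      ∏ j, (Complex.Gamma ((B j : ℂ) * s + (b j : ℂ)))⁻¹ := by
    ext s
    rw [gammaRatio, div_eq_mul_inv, Finset.prod_inv_distrib]
  rw [e]
  refine DifferentiableAt.mul ?_ ?_
  · refine DifferentiableAt.fun_finsetProd fun k _ => ?_
    exact (Complex.differentiableAt_Gamma _ (h k)).comp s
      (f := fun s : ℂ => (A k : ℂ) * s + (a k : ℂ)) (by fun_prop)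
  · refine DifferentiableAt.fun_finsetProd fun k _ => ?_
    exact (Complex.differentiable_one_div_Gamma _).comp s
      (f := fun s : ℂ => (B k : ℂ) * s + (b k : ℂ)) (by fun_prop)

lemma differentiableAt_gammaRatio_of_im_ne_zero {A a : Fin p → ℝ} {B b : Fin q → ℝ}
    (hA : ∀ k, 0 < A k) {s : ℂ} (hs : s.im ≠ 0) :
    DifferentiableAt ℂ (gammaRatio A a B b) s := by
  refine differentiableAt_gammaRatio fun k n h => ?_
  have := congrArg Complex.im h
  simp at this
  exact this.elim (fun h => (hA k).ne' h) hs

lemma differentiableAt_gammaRatio_of_lt_re {A a : Fin p → ℝ} {B b : Fin q → ℝ}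
    (hA : ∀ k, 0 < A k) {s : ℂ} (hs : ∀ k, -(a k / A k) < s.re) :
    DifferentiableAt ℂ (gammaRatio A a B b) s := by
  refine differentiableAt_gammaRatio fun k n h => ?_
  have := congrArg Complex.re h
  simp at this
  have h1 := hs k
  rw [← neg_div, div_lt_iff₀' (hA k)] at h1
  have : (0 : ℝ) ≤ n := n.cast_nonneg
  linarith

lemma normRatio_eq_mul_exp {A a : Fin p → ℝ} {B b : Fin q → ℝ} (hA : ∀ k, 0 < A k)
    (hB : ∀ j, 0 < B j) :
    normRatio A a B b = fun s => gammaRatio A a B b s * Complex.exp (-s * Real.log (rho A B)) := by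
  ext s
  rw [normRatio, Complex.cpow_def_of_ne_zero (by exact_mod_cast (rho_pos hA hB).ne'),
    ← Complex.ofReal_log (rho_pos hA hB).le, mul_comm (-s)]

lemma differentiableAt_normRatio {A a : Fin p → ℝ} {B b : Fin q → ℝ} (hA : ∀ k, 0 < A k)
    (hB : ∀ j, 0 < B j) {s : ℂ} (hs : DifferentiableAt ℂ (gammaRatio A a B b) s) :
    DifferentiableAt ℂ (normRatio A a B b) s := by
  rw [normRatio_eq_mul_exp hA hB]
  fun_prop

/-- The normalised gamma ratio is `nu` plus the Laplace transform of a continuous function that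
solves a Volterra equation. -/
theorem exists_normRatio_eq {A a : Fin p → ℝ} {B b : Fin q → ℝ} (hA : ∀ k, 0 < A k)
    (hB : ∀ j, 0 < B j) (hmu : mu a b = 0) (hDelta : ∑ j, B j - ∑ k, A k = 0) :
    ∃ σ, 0 < σ ∧ ∃ h : ℝ → ℝ, Continuous h ∧ ExpBounded σ h ∧
      (∀ t, 0 < t → t * h t = nu A a B b * (t * kern A a B b t)
        + ∫ w in (0 : ℝ)..t, h w * ((t - w) * kern A a B b (t - w))) ∧
      ∀ s : ℂ, σ < s.re → normRatio A a B b s = nu A a B b + lap h s := by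
  obtain ⟨σ, hσ, h, hhc, hh, heq⟩ :=
    exists_solution (continuous_kern A a B b) (expBounded_kern (a := a) (b := b) hA hB)
      (nu A a B b)
  have h0 := kernOrder_nonneg (a := a) (b := b) hA hB
  refine ⟨σ, h0.trans_lt hσ, h, hhc, hh, heq, ?_⟩
  have hopen : IsOpen {s : ℂ | σ < s.re} := isOpen_lt continuous_const Complex.continuous_re
  have f1 : AnalyticOnNhd ℂ (normRatio A a B b) {s : ℂ | σ < s.re} := by
    refine DifferentiableOn.analyticOnNhd (fun s hs => ?_) hopen
    refine (differentiableAt_normRatio hA hB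
      (differentiableAt_gammaRatio_of_lt_re hA fun k => ?_)).differentiableWithinAt
    have h1 := le_kernOrder_left (a := a) (b := b) hA hB k
    have h2 : -(a k / A k) ≤ |a k| / A k := by
      rw [← neg_div]
      have := hA k
      gcongr
      exact neg_le_abs _
    have hs : σ < s.re := hs
    linarith
  have f2 : AnalyticOnNhd ℂ (fun s => nu A a B b + lap h s) {s : ℂ | σ < s.re} :=
    DifferentiableOn.analyticOnNhd (fun s hs =>
      ((hh.hasDerivAt_lap hs).const_add _).differentiableAt.differentiableWithinAt) hopen
  have hz : ((σ + 1 : ℝ) : ℂ) ∈ {s : ℂ | σ < s.re} := by simp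
  intro s hs
  refine f1.eqOn_of_preconnected_of_frequently_eq f2
    (convex_halfSpace_re_gt σ).isPreconnected hz ?_ hs
  -- The two functions are compared on real points accumulating at `σ + 1`, which suffices for the
  -- identity theorem.
  have ht : Tendsto (fun n : ℕ => ((σ + 1 + 1 / ((n : ℝ) + 1) : ℝ) : ℂ)) atTop
      (𝓝[≠] ((σ + 1 : ℝ) : ℂ)) := by
    refine tendsto_nhdsWithin_iff.2 ⟨?_, Eventually.of_forall fun n => ?_⟩
    · have := (tendsto_one_div_add_atTop_nhds_zero_nat (𝕜 := ℝ)).const_add (σ + 1)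
      rw [add_zero] at this
      exact (Complex.continuous_ofReal.tendsto _).comp this
    · have : 1 / ((n : ℝ) + 1) ≠ 0 := by positivity
      simp only [mem_compl_iff, mem_singleton_iff, Complex.ofReal_inj]
      intro h
      exact this (by linarith)
  refine ht.frequently (Frequently.of_forall fun n => ?_)
  have hn : 0 < 1 / ((n : ℝ) + 1) := by positivity
  rw [normRatio_ofReal hA hB hmu hDelta (by linarith), lap_ofReal,
    ← add_rlap_solution (expBounded_kern hA hB) hσ hh heq (by linarith)]
  push_cast
  rfl

/-! ### Boundedness of the normalised ratio away from the real axis. -/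

lemma norm_Gamma_le_Gamma_re {z : ℂ} (hz : 0 < z.re) : ‖Complex.Gamma z‖ ≤ Real.Gamma z.re := by
  rw [Complex.Gamma_eq_integral hz, Real.Gamma_eq_integral hz, Complex.GammaIntegral]
  refine (norm_integral_le_integral_norm _).trans_eq ?_
  refine setIntegral_congr_fun measurableSet_Ioi fun t ht => ?_
  simp only [norm_mul, Complex.norm_real, Real.norm_eq_abs, abs_of_pos (Real.exp_pos _)]
  rw [Complex.norm_cpow_eq_rpow_re_of_pos ht]
  simp

/-- Induction leftwards by unit strips through `Γ z = Γ (z + 1) / z`, where `|z| ≥ δ`. The condition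
`2 ≤ M` keeps `z + 1` inside the strip. -/
lemma exists_norm_Gamma_le_of_re_ge (M δ : ℝ) (hM : 2 ≤ M) (hδ : 0 < δ) (n : ℕ) :
    ∃ C, 0 ≤ C ∧ ∀ z : ℂ, 1 - n ≤ z.re → z.re ≤ M → δ ≤ |z.im| → ‖Complex.Gamma z‖ ≤ C := by
  induction n with
  | zero =>
    obtain ⟨C, hC⟩ := isCompact_Icc.exists_bound_of_continuousOn (s := Icc (1 : ℝ) M)
      (f := Real.Gamma) (fun x hx => (Real.differentiableAt_Gamma
        fun m h => by linarith [hx.1, (m.cast_nonneg : (0 : ℝ) ≤ m)]).continuousAt.continuousWithinAt)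
    refine ⟨C, (norm_nonneg _).trans (hC 1 ⟨le_rfl, by linarith⟩), fun z h1 h2 _ => ?_⟩
    simp only [Nat.cast_zero, sub_zero] at h1
    exact (norm_Gamma_le_Gamma_re (by linarith)).trans
      ((le_abs_self _).trans (hC z.re ⟨h1, h2⟩))
  | succ n ih =>
    obtain ⟨C, hC0, hC⟩ := ih
    refine ⟨max C (C / δ), le_max_of_le_left hC0, fun z h1 h2 h3 => ?_⟩
    push_cast at h1
    rcases le_total (1 - (n : ℝ)) z.re with h | h
    · exact (hC z h h2 h3).trans (le_max_left _ _)
    · have hz : z ≠ 0 := by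
        rintro rfl
        simp at h3
        linarith
      have hzn : δ ≤ ‖z‖ := h3.trans (Complex.abs_im_le_norm z)
      have hn : (0 : ℝ) ≤ n := n.cast_nonneg
      have h4 := hC (z + 1) (by simp; linarith) (by simp; linarith) (by simpa using h3)
      rw [Complex.Gamma_add_one z hz, norm_mul] at h4
      refine le_max_of_le_right ?_
      rw [le_div_iff₀ hδ]
      calc ‖Complex.Gamma z‖ * δ ≤ ‖Complex.Gamma z‖ * ‖z‖ := by gcongr
        _ ≤ C := by rw [mul_comm]; exact h4

/-- The gamma function is bounded on vertical strips, away from the real axis. -/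
lemma exists_norm_Gamma_le (M δ : ℝ) (hδ : 0 < δ) :
    ∃ C, 0 ≤ C ∧ ∀ z : ℂ, |z.re| ≤ M → δ ≤ |z.im| → ‖Complex.Gamma z‖ ≤ C := by
  obtain ⟨n, hn⟩ := exists_nat_ge (M + 1)
  obtain ⟨C, hC0, hC⟩ := exists_norm_Gamma_le_of_re_ge (max M 2) δ (le_max_right _ _) hδ n
  refine ⟨C, hC0, fun z h1 h2 => hC z ?_ ((le_abs_self _).trans (h1.trans (le_max_left _ _))) h2⟩
  linarith [neg_abs_le z.re]

lemma norm_sin_le (w : ℂ) : ‖Complex.sin w‖ ≤ Real.exp |w.im| := by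
  rw [Complex.sin]
  have h1 : ‖Complex.exp (-w * Complex.I)‖ ≤ Real.exp |w.im| := by
    rw [Complex.norm_exp]
    simpa using le_abs_self w.im
  have h2 : ‖Complex.exp (w * Complex.I)‖ ≤ Real.exp |w.im| := by
    rw [Complex.norm_exp]
    simpa using neg_le_abs w.im
  rw [norm_div, norm_mul, Complex.norm_I, mul_one]
  have := norm_sub_le (Complex.exp (-w * Complex.I)) (Complex.exp (w * Complex.I))
  simp only [Complex.norm_ofNat]
  linarith

lemma le_norm_sin {δ : ℝ} {w : ℂ} (hw : δ ≤ |w.im|) :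
    (1 - Real.exp (-(2 * δ))) / 2 * Real.exp |w.im| ≤ ‖Complex.sin w‖ := by
  rw [Complex.sin]
  have h1 : ‖Complex.exp (-w * Complex.I)‖ = Real.exp w.im := by
    rw [Complex.norm_exp]; simp
  have h2 : ‖Complex.exp (w * Complex.I)‖ = Real.exp (-w.im) := by
    rw [Complex.norm_exp]; simp
  rw [norm_div, norm_mul, Complex.norm_I, mul_one]
  have h := abs_norm_sub_norm_le (Complex.exp (-w * Complex.I)) (Complex.exp (w * Complex.I))
  rw [h1, h2] at h
  have h3 : Real.exp |w.im| - Real.exp (-|w.im|) ≤ |Real.exp w.im - Real.exp (-w.im)| := by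
    rcases abs_cases w.im with ⟨h, _⟩ | ⟨h, _⟩
    · rw [h]; exact le_abs_self _
    · rw [h, neg_neg, abs_sub_comm]; exact le_abs_self _
  have h4 : Real.exp (-|w.im|) ≤ Real.exp (-(2 * δ)) * Real.exp |w.im| := by
    rw [← Real.exp_add]
    exact Real.exp_le_exp.2 (by linarith)
  simp only [Complex.norm_ofNat]
  linarith

lemma sin_ne_zero_of_im_ne_zero {w : ℂ} (hw : w.im ≠ 0) : Complex.sin w ≠ 0 := by
  have h := le_norm_sin (δ := |w.im|) le_rfl
  have h1 : Real.exp (-(2 * |w.im|)) < 1 := by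
    rw [Real.exp_lt_one_iff]
    have := abs_pos.2 hw
    linarith
  intro h0
  rw [h0, norm_zero] at h
  have := mul_pos (half_pos (sub_pos.2 h1)) (Real.exp_pos |w.im|)
  linarith

lemma im_pi_mul (z : ℂ) : ((Real.pi : ℂ) * z).im = Real.pi * z.im := by simp

lemma inv_Gamma_eq {z : ℂ} (hz : z.im ≠ 0) :
    (Complex.Gamma z)⁻¹ = Complex.Gamma (1 - z) * (Complex.sin (Real.pi * z) / Real.pi) := by
  have h := Complex.Gamma_mul_Gamma_one_sub z
  have hs : Complex.sin (Real.pi * z) ≠ 0 := sin_ne_zero_of_im_ne_zero (by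
    rw [im_pi_mul]; exact mul_ne_zero Real.pi_pos.ne' hz)
  have hpi : (Real.pi : ℂ) ≠ 0 := by exact_mod_cast Real.pi_pos.ne'
  rw [eq_div_iff hs] at h
  refine inv_eq_of_mul_eq_one_right ?_
  rw [← mul_assoc, ← mul_div_assoc, h, div_self hpi]

/-- By reflection, `1 / Γ z` is `Γ (1 - z)`, which is bounded here, times `sin (π z) / π`, which
causes the exponential. -/
lemma exists_norm_inv_Gamma_le (M δ : ℝ) (hδ : 0 < δ) :
    ∃ C, 0 ≤ C ∧ ∀ z : ℂ, |z.re| ≤ M → δ ≤ |z.im| →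
      ‖(Complex.Gamma z)⁻¹‖ ≤ C * Real.exp (Real.pi * |z.im|) := by
  obtain ⟨C, hC0, hC⟩ := exists_norm_Gamma_le (M + 1) δ hδ
  refine ⟨C * (1 / Real.pi), by positivity, fun z h1 h2 => ?_⟩
  have hz : z.im ≠ 0 := fun h => by rw [h, abs_zero] at h2; linarith
  have h3 := norm_sin_le (Real.pi * z)
  rw [im_pi_mul, abs_mul, abs_of_pos Real.pi_pos] at h3
  rw [inv_Gamma_eq hz, norm_mul, norm_div, Complex.norm_real, Real.norm_eq_abs,
    abs_of_pos Real.pi_pos, mul_assoc, one_div_mul_eq_div]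
  have h4 : |(1 - z).re| ≤ M + 1 := by
    have := abs_sub 1 z.re
    simp only [Complex.sub_re, Complex.one_re]
    rw [abs_one] at this
    linarith
  have h5 := hC (1 - z) h4 (by simpa using h2)
  gcongr

lemma exists_norm_prod_Gamma_le {n : ℕ} {A : Fin n → ℝ} (hA : ∀ k, 0 < A k) (a : Fin n → ℝ)
    (M φ : ℝ) (hφ : 0 < φ) :
    ∃ C, 0 ≤ C ∧ ∀ s : ℂ, |s.re| ≤ M → φ ≤ |s.im| →
      ‖∏ k, Complex.Gamma ((A k : ℂ) * s + a k)‖ ≤ C := by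
  have h := fun k => exists_norm_Gamma_le (A k * M + |a k|) (A k * φ) (mul_pos (hA k) hφ)
  choose C hC0 hC using h
  refine ⟨∏ k, C k, Finset.prod_nonneg fun k _ => hC0 k, fun s h1 h2 => ?_⟩
  rw [norm_prod]
  refine Finset.prod_le_prod (fun k _ => norm_nonneg _) fun k _ => hC k _ ?_ ?_
  · simp only [Complex.add_re, Complex.re_ofReal_mul, Complex.ofReal_re]
    refine (abs_add_le _ _).trans ?_
    rw [abs_mul, abs_of_pos (hA k)]
    have := hA k
    gcongr
  · simp only [Complex.add_im, Complex.im_ofReal_mul, Complex.ofReal_im, add_zero]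
    rw [abs_mul, abs_of_pos (hA k)]
    have := hA k
    gcongr

lemma exists_norm_prod_inv_Gamma_le {n : ℕ} {A : Fin n → ℝ} (hA : ∀ k, 0 < A k)
    (a : Fin n → ℝ) (M φ : ℝ) (hφ : 0 < φ) :
    ∃ C, 0 ≤ C ∧ ∀ s : ℂ, |s.re| ≤ M → φ ≤ |s.im| →
      ‖∏ k, (Complex.Gamma ((A k : ℂ) * s + a k))⁻¹‖
        ≤ C * Real.exp ((Real.pi * ∑ k, A k) * |s.im|) := by
  have h := fun k => exists_norm_inv_Gamma_le (A k * M + |a k|) (A k * φ) (mul_pos (hA k) hφ)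
  choose C hC0 hC using h
  refine ⟨∏ k, C k, Finset.prod_nonneg fun k _ => hC0 k, fun s h1 h2 => ?_⟩
  rw [norm_prod, Finset.mul_sum, Finset.sum_mul, Real.exp_sum, ← Finset.prod_mul_distrib]
  refine Finset.prod_le_prod (fun k _ => norm_nonneg _) fun k _ => (hC k _ ?_ ?_).trans_eq ?_
  · simp only [Complex.add_re, Complex.re_ofReal_mul, Complex.ofReal_re]
    refine (abs_add_le _ _).trans ?_
    rw [abs_mul, abs_of_pos (hA k)]
    have := hA k
    gcongr
  · simp only [Complex.add_im, Complex.im_ofReal_mul, Complex.ofReal_im, add_zero]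
    rw [abs_mul, abs_of_pos (hA k)]
    have := hA k
    gcongr
  · simp only [Complex.add_im, Complex.im_ofReal_mul, Complex.ofReal_im, add_zero]
    rw [abs_mul, abs_of_pos (hA k), mul_assoc Real.pi]

lemma norm_rho_cpow {A : Fin p → ℝ} {B : Fin q → ℝ} (hA : ∀ k, 0 < A k)
    (hB : ∀ j, 0 < B j) (s : ℂ) :
    ‖(rho A B : ℂ) ^ (-s)‖ = Real.exp (-s.re * Real.log (rho A B)) := by
  rw [Complex.norm_cpow_eq_rpow_re_of_pos (rho_pos hA hB), Real.rpow_def_of_pos (rho_pos hA hB)]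
  simp [mul_comm]

/-- A priori exponential bound in vertical strips. -/
lemma exists_norm_normRatio_le_exp {A : Fin p → ℝ} (a : Fin p → ℝ) {B : Fin q → ℝ}
    (b : Fin q → ℝ) (hA : ∀ k, 0 < A k) (hB : ∀ j, 0 < B j) (M φ : ℝ) (hφ : 0 < φ) :
    ∃ C D, ∀ s : ℂ, |s.re| ≤ M → φ ≤ |s.im| →
      ‖normRatio A a B b s‖ ≤ C * Real.exp (D * |s.im|) := by
  obtain ⟨C, hC0, hC⟩ := exists_norm_prod_Gamma_le hA a M φ hφ
  obtain ⟨C', hC'0, hC'⟩ := exists_norm_prod_inv_Gamma_le hB b M φ hφ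
  refine ⟨C * C' * Real.exp (M * |Real.log (rho A B)|), Real.pi * ∑ k, B k, fun s h1 h2 => ?_⟩
  rw [normRatio, gammaRatio, div_eq_mul_inv, ← Finset.prod_inv_distrib, norm_mul, norm_mul,
    norm_rho_cpow hA hB]
  have h3 : -s.re * Real.log (rho A B) ≤ M * |Real.log (rho A B)| := by
    refine (le_abs_self _).trans ?_
    rw [abs_mul, abs_neg]
    gcongr
  calc _ ≤ C * (C' * Real.exp ((Real.pi * ∑ k, B k) * |s.im|))
        * Real.exp (M * |Real.log (rho A B)|) := by
        gcongr
        · exact hC s h1 h2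
        · exact hC' s h1 h2
    _ = _ := by ring

/-- **Phragmén–Lindelöf** in a vertical half-strip. -/
lemma exists_bound_of_bound_on_edges {f : ℂ → ℂ} {M φ C K D : ℝ} (hM : 0 < M) (hφ : 0 < φ)
    (hd : ∀ s : ℂ, 0 < s.im → DifferentiableAt ℂ f s)
    (hedge : ∀ s : ℂ, |s.re| = M → φ ≤ s.im → ‖f s‖ ≤ C)
    (hgrow : ∀ s : ℂ, |s.re| ≤ M → φ ≤ s.im → ‖f s‖ ≤ K * Real.exp (D * s.im)) :
    ∃ C', ∀ s : ℂ, |s.re| ≤ M → φ ≤ s.im → ‖f s‖ ≤ C' := by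
  -- The three entries serve the top edge, the vertical edges and the bottom edge of a rectangle.
  set C' := max 1 (max C (K * Real.exp (D * φ))) with hC'
  have hC'1 : 1 ≤ C' := le_max_left _ _
  have hCC : C ≤ C' := (le_max_left _ _).trans (le_max_right _ _)
  have hKC : K * Real.exp (D * φ) ≤ C' := (le_max_right _ _).trans (le_max_right _ _)
  refine ⟨C', fun s hs1 hs2 => ?_⟩
  have hgauss : ∀ (ε : ℝ) (z : ℂ),
      ‖Complex.exp (ε * z ^ 2)‖ = Real.exp (ε * (z.re ^ 2 - z.im ^ 2)) := by
    intro ε z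
    rw [Complex.norm_exp, Complex.re_ofReal_mul]
    congr 2
    rw [pow_two, Complex.mul_re]
    ring
  -- The factor `exp (ε z ^ 2)` beats the growth `exp (D y)`, so the maximum principle applies on a
  -- tall enough rectangle; then `ε → 0`.
  have main : ∀ ε : ℝ, 0 < ε →
      ‖f s‖ * Real.exp (ε * (s.re ^ 2 - s.im ^ 2)) ≤ C' * Real.exp (ε * M ^ 2) := by
    intro ε hε
    have hlim : Tendsto (fun y : ℝ => K * Real.exp (D * y - ε * y ^ 2)) atTop (𝓝 0) := by
      have h1 : Tendsto (fun y : ℝ => y * (ε * y - D)) atTop atTop :=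
        tendsto_id.atTop_mul_atTop₀
          (tendsto_atTop_add_const_right _ (-D) (tendsto_id.const_mul_atTop hε))
      have h2 := (Real.tendsto_exp_neg_atTop_nhds_zero.comp h1).const_mul K
      rw [mul_zero] at h2
      refine h2.congr fun y => ?_
      simp only [Function.comp_apply]
      ring_nf
    obtain ⟨Y, hY1, hYs, hYφ⟩ := ((hlim.eventually_le_const (zero_lt_one)).and
      ((eventually_gt_atTop s.im).and (eventually_gt_atTop φ))).exists
    set U : Set ℂ := Ioo (-M) M ×ℂ Ioo φ Y with hU
    have hcl : closure U = Icc (-M) M ×ℂ Icc φ Y := by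
      rw [hU, Complex.closure_reProdIm, closure_Ioo (by linarith), closure_Ioo hYφ.ne]
    have hUb : Bornology.IsBounded U :=
      (Metric.isBounded_Ioo _ _).reProdIm (Metric.isBounded_Ioo _ _)
    have hdU : DiffContOnCl ℂ (fun z => f z * Complex.exp (ε * z ^ 2)) U := by
      refine DifferentiableOn.diffContOnCl fun z hz => ?_
      rw [hcl] at hz
      have hz0 : 0 < z.im := hφ.trans_le hz.2.1
      have := hd z hz0
      exact (this.mul (by fun_prop)).differentiableWithinAt
    have hs_mem : s ∈ closure U := by
      rw [hcl]
      exact ⟨abs_le.1 hs1, hs2, hYs.le⟩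
    have hfr : ∀ z ∈ frontier U,
        ‖f z * Complex.exp (ε * z ^ 2)‖ ≤ C' * Real.exp (ε * M ^ 2) := by
      intro z hz
      rw [hU, Complex.frontier_reProdIm, closure_Ioo (by linarith), closure_Ioo hYφ.ne,
        frontier_Ioo hYφ, frontier_Ioo (by linarith)] at hz
      rw [norm_mul, hgauss]
      have hre : |z.re| ≤ M := by
        rcases hz with ⟨h1, _⟩ | ⟨h1, _⟩
        · exact abs_le.2 h1
        · rcases h1 with h1 | h1 <;> rw [h1] <;> simp [abs_of_pos hM]
      have hre2 : z.re ^ 2 ≤ M ^ 2 := sq_le_sq.2 (by rwa [abs_of_pos hM])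
      rcases hz with ⟨_, h2⟩ | ⟨h1, h2⟩
      · rcases h2 with h2 | h2
        · have h3 := hgrow z hre h2.ge
          rw [h2] at h3
          refine mul_le_mul (h3.trans hKC) ?_ (Real.exp_pos _).le (by linarith)
          refine Real.exp_le_exp.2 (mul_le_mul_of_nonneg_left ?_ hε.le)
          nlinarith [sq_nonneg z.im]
        · have h3 := hgrow z hre (by rw [h2]; exact hYφ.le)
          rw [h2] at h3 ⊢
          calc ‖f z‖ * Real.exp (ε * (z.re ^ 2 - Y ^ 2))
              ≤ (K * Real.exp (D * Y)) * Real.exp (ε * (M ^ 2 - Y ^ 2)) := by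
                have := (norm_nonneg _).trans h3
                gcongr
            _ = (K * Real.exp (D * Y - ε * Y ^ 2)) * Real.exp (ε * M ^ 2) := by
              rw [mul_assoc, mul_assoc, ← Real.exp_add, ← Real.exp_add]; ring_nf
            _ ≤ C' * Real.exp (ε * M ^ 2) := by gcongr; linarith
      · have h3 : |z.re| = M := by
          rcases h1 with h1 | h1 <;> rw [h1] <;> simp [abs_of_pos hM]
        refine mul_le_mul ((hedge z h3 h2.1).trans hCC) ?_ (Real.exp_pos _).le (by linarith)
        refine Real.exp_le_exp.2 (mul_le_mul_of_nonneg_left ?_ hε.le)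
        nlinarith [sq_nonneg z.im]
    have := Complex.norm_le_of_forall_mem_frontier_norm_le hUb hdU hfr hs_mem
    rwa [norm_mul, hgauss] at this
  have l1 : Tendsto (fun ε : ℝ => ‖f s‖ * Real.exp (ε * (s.re ^ 2 - s.im ^ 2))) (𝓝[>] 0)
      (𝓝 (‖f s‖ * Real.exp (0 * (s.re ^ 2 - s.im ^ 2)))) :=
    ((by fun_prop : Continuous fun ε : ℝ =>
      ‖f s‖ * Real.exp (ε * (s.re ^ 2 - s.im ^ 2))).tendsto 0).mono_left nhdsWithin_le_nhds
  have l2 : Tendsto (fun ε : ℝ => C' * Real.exp (ε * M ^ 2)) (𝓝[>] 0)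
      (𝓝 (C' * Real.exp (0 * M ^ 2))) :=
    ((by fun_prop : Continuous fun ε : ℝ => C' * Real.exp (ε * M ^ 2)).tendsto 0).mono_left
      nhdsWithin_le_nhds
  have := le_of_tendsto_of_tendsto l1 l2 (by
    filter_upwards [self_mem_nhdsWithin] with ε hε using main ε hε)
  simpa using this

lemma exists_norm_normRatio_le_right {A a : Fin p → ℝ} {B b : Fin q → ℝ} (hA : ∀ k, 0 < A k)
    (hB : ∀ j, 0 < B j) (hmu : mu a b = 0) (hDelta : ∑ j, B j - ∑ k, A k = 0) :
    ∃ M C, 0 < M ∧ ∀ s : ℂ, M ≤ s.re → ‖normRatio A a B b s‖ ≤ C := by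
  obtain ⟨σ, hσ, h, -, hh, -, heq⟩ := exists_normRatio_eq hA hB hmu hDelta
  obtain ⟨C, hC0, hC⟩ := hh.norm_lap_le
  refine ⟨σ + 1, ‖(nu A a B b : ℂ)‖ + C, by linarith, fun s hs => ?_⟩
  rw [heq s (by linarith)]
  refine (norm_add_le _ _).trans (add_le_add le_rfl ((hC s (by linarith)).trans ?_))
  exact div_le_self hC0 (by linarith)

lemma rho_swap {A : Fin p → ℝ} {B : Fin q → ℝ} (hA : ∀ k, 0 < A k) (hB : ∀ j, 0 < B j) :
    Real.log (rho B A) = -Real.log (rho A B) := by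
  rw [rho_eq_exp hA hB, rho_eq_exp hB hA, Real.log_exp, Real.log_exp]
  ring

/-- Reflection exchanges numerator and denominator and replaces parameters by `1` minus themselves.
As `μ` is preserved, the right half-plane bound applies to the reflected data, whose parameters may
be negative. -/
lemma mu_reflect {a : Fin p → ℝ} {b : Fin q → ℝ} :
    mu (fun j => 1 - b j) (fun k => 1 - a k) = mu a b := by
  simp only [mu, Finset.sum_sub_distrib]
  simp
  ring

lemma normRatio_reflect {A a : Fin p → ℝ} {B b : Fin q → ℝ} (hA : ∀ k, 0 < A k)
    (hB : ∀ j, 0 < B j) {s : ℂ} (hs : s.im ≠ 0) :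
    normRatio A a B b s =
      (∏ j, Complex.sin (Real.pi * ((B j : ℂ) * s + b j)) / Real.pi) *
      (∏ k, Complex.sin (Real.pi * ((A k : ℂ) * s + a k)) / Real.pi)⁻¹ *
      normRatio B (fun j => 1 - b j) A (fun k => 1 - a k) (-s) := by
  have him : ∀ c d : ℝ, 0 < c → ((c : ℂ) * s + d).im ≠ 0 := by
    intro c d hc
    simp [hc.ne', hs]
  have e1 : ∀ k, Complex.Gamma ((A k : ℂ) * s + a k) =
      (Complex.sin (Real.pi * ((A k : ℂ) * s + a k)) / Real.pi)⁻¹ *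
        (Complex.Gamma ((A k : ℂ) * (-s) + (1 - a k : ℝ)))⁻¹ := by
    intro k
    rw [← mul_inv, ← inv_inj, inv_inv, inv_Gamma_eq (him _ _ (hA k)), mul_comm]
    push_cast
    ring_nf
  have e2 : ∀ k, (Complex.Gamma ((B k : ℂ) * s + b k))⁻¹ =
      (Complex.sin (Real.pi * ((B k : ℂ) * s + b k)) / Real.pi) *
        Complex.Gamma ((B k : ℂ) * (-s) + (1 - b k : ℝ)) := by
    intro k
    rw [inv_Gamma_eq (him _ _ (hB k)), mul_comm]
    push_cast
    ring_nf
  simp only [normRatio_eq_mul_exp hA hB, normRatio_eq_mul_exp hB hA, rho_swap hA hB, gammaRatio,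
    div_eq_mul_inv _ (∏ j, Complex.Gamma _), ← Finset.prod_inv_distrib]
  rw [Finset.prod_congr rfl fun k _ => e1 k, Finset.prod_congr rfl fun k _ => e2 k,
    Finset.prod_mul_distrib, Finset.prod_mul_distrib,
    Finset.prod_inv_distrib fun k => Complex.sin (Real.pi * ((A k : ℂ) * s + a k)) / Real.pi,
    show -(-s) * ((-Real.log (rho A B) : ℝ) : ℂ) = -s * (Real.log (rho A B) : ℝ) by
      push_cast; ring]
  ring

/-- Reflection moves `s` to the right half-plane at the price of a quotient of sine products. Off
the real axis each sine is comparable to the exponential of its imaginary part, and since `∑ B = ∑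
A` these exponentials cancel. -/
lemma exists_norm_normRatio_le_left {A a : Fin p → ℝ} {B b : Fin q → ℝ} (hA : ∀ k, 0 < A k)
    (hB : ∀ j, 0 < B j) (hmu : mu a b = 0) (hDelta : ∑ j, B j - ∑ k, A k = 0) {φ : ℝ}
    (hφ : 0 < φ) :
    ∃ M C, 0 < M ∧ ∀ s : ℂ, s.re ≤ -M → φ ≤ |s.im| → ‖normRatio A a B b s‖ ≤ C := by
  obtain ⟨M, C, hM, hC⟩ := exists_norm_normRatio_le_right (A := B) (a := fun j => 1 - b j)
    (B := A) (b := fun k => 1 - a k) hB hA (by rw [mu_reflect, hmu]) (by linarith)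
  set c : Fin p → ℝ := fun k => (1 - Real.exp (-(2 * (Real.pi * (A k * φ))))) / 2 / Real.pi
    with hc
  have hcpos : ∀ k, 0 < c k := by
    intro k
    have : Real.exp (-(2 * (Real.pi * (A k * φ)))) < 1 := by
      rw [Real.exp_lt_one_iff]
      have := mul_pos Real.pi_pos (mul_pos (hA k) hφ)
      linarith
    have := Real.pi_pos
    simp only [hc]
    have : 0 < 1 - Real.exp (-(2 * (Real.pi * (A k * φ)))) := by linarith
    positivity
  refine ⟨M, (∏ _j : Fin q, 1 / Real.pi) * (∏ k, c k)⁻¹ * C, hM, fun s h1 h2 => ?_⟩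
  have hs : s.im ≠ 0 := fun h => by rw [h, abs_zero] at h2; linarith
  have him : ∀ x d : ℝ, 0 < x → |((Real.pi : ℂ) * ((x : ℂ) * s + d)).im|
      = Real.pi * (x * |s.im|) := by
    intro x d hx
    rw [im_pi_mul, abs_mul, abs_of_pos Real.pi_pos]
    simp [abs_mul, abs_of_pos hx]
  rw [normRatio_reflect hA hB hs, norm_mul, norm_mul, norm_inv, norm_prod, norm_prod]
  have hS : ∑ j, B j = ∑ k, A k := by linarith
  have b1 : ∏ j, ‖Complex.sin (Real.pi * ((B j : ℂ) * s + b j)) / Real.pi‖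
      ≤ (∏ _j : Fin q, 1 / Real.pi) * Real.exp (Real.pi * ((∑ k, A k) * |s.im|)) := by
    rw [← hS, Finset.sum_mul, Finset.mul_sum, Real.exp_sum, ← Finset.prod_mul_distrib]
    refine Finset.prod_le_prod (fun _ _ => norm_nonneg _) fun j _ => ?_
    rw [norm_div, Complex.norm_real, Real.norm_eq_abs, abs_of_pos Real.pi_pos,
      one_div_mul_eq_div]
    have := norm_sin_le (Real.pi * ((B j : ℂ) * s + b j))
    rw [him _ _ (hB j)] at this
    have := Real.pi_pos
    gcongr
  have b2 : (∏ k, c k) * Real.exp (Real.pi * ((∑ k, A k) * |s.im|))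
      ≤ ∏ k, ‖Complex.sin (Real.pi * ((A k : ℂ) * s + a k)) / Real.pi‖ := by
    rw [Finset.sum_mul, Finset.mul_sum, Real.exp_sum, ← Finset.prod_mul_distrib]
    refine Finset.prod_le_prod (fun k _ => (mul_pos (hcpos k) (Real.exp_pos _)).le) fun k _ => ?_
    rw [norm_div, Complex.norm_real, Real.norm_eq_abs, abs_of_pos Real.pi_pos]
    have hAk := hA k
    have := Real.pi_pos
    have h := le_norm_sin (δ := Real.pi * (A k * φ)) (w := Real.pi * ((A k : ℂ) * s + a k)) (by
      rw [him _ _ hAk]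
      gcongr)
    rw [him _ _ hAk] at h
    simp only [hc]
    rw [div_mul_eq_mul_div]
    gcongr
  have hcp : 0 < ∏ k, c k := Finset.prod_pos fun k _ => hcpos k
  have hE := Real.exp_pos (Real.pi * ((∑ k, A k) * |s.im|))
  have b3 := hC (-s) (by simp; linarith)
  calc _ ≤ ((∏ _j : Fin q, 1 / Real.pi) * Real.exp (Real.pi * ((∑ k, A k) * |s.im|)))
        * ((∏ k, c k) * Real.exp (Real.pi * ((∑ k, A k) * |s.im|)))⁻¹ * C := by
        gcongr
    _ = _ := by field_simp

/-- The normalised gamma ratio is bounded away from the real axis. -/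
theorem exists_norm_normRatio_le {A a : Fin p → ℝ} {B b : Fin q → ℝ} (hA : ∀ k, 0 < A k)
    (hB : ∀ j, 0 < B j) (hmu : mu a b = 0) (hDelta : ∑ j, B j - ∑ k, A k = 0) {φ : ℝ}
    (hφ : 0 < φ) :
    ∃ C, ∀ s : ℂ, φ ≤ |s.im| → ‖normRatio A a B b s‖ ≤ C := by
  obtain ⟨M₁, C₁, hM₁, hC₁⟩ := exists_norm_normRatio_le_right hA hB hmu hDelta
  obtain ⟨M₂, C₂, hM₂, hC₂⟩ := exists_norm_normRatio_le_left hA hB hmu hDelta hφ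
  set M := max M₁ M₂ with hM
  have hM1 : M₁ ≤ M := le_max_left _ _
  have hM2 : M₂ ≤ M := le_max_right _ _
  have hM0 : 0 < M := hM₁.trans_le hM1
  obtain ⟨K, D, hK⟩ := exists_norm_normRatio_le_exp a b hA hB M φ hφ
  have hout : ∀ s : ℂ, M ≤ |s.re| → φ ≤ |s.im| → ‖normRatio A a B b s‖ ≤ max C₁ C₂ := by
    intro s h1 h2
    rcases le_abs.1 h1 with h | h
    · exact (hC₁ s (hM1.trans h)).trans (le_max_left _ _)
    · exact (hC₂ s (by linarith) h2).trans (le_max_right _ _)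
  have hd : ∀ s : ℂ, s.im ≠ 0 → DifferentiableAt ℂ (normRatio A a B b) s := fun s hs =>
    differentiableAt_normRatio hA hB (differentiableAt_gammaRatio_of_im_ne_zero hA hs)
  obtain ⟨C₃, hC₃⟩ := exists_bound_of_bound_on_edges (f := normRatio A a B b) hM0 hφ
    (fun s hs => hd s hs.ne')
    (fun s h1 h2 => hout s h1.ge (h2.trans (le_abs_self _)))
    (fun s h1 h2 => by
      have := hK s h1 (h2.trans (le_abs_self _))
      rwa [abs_of_pos (hφ.trans_le h2)] at this)
  -- The lower half-strip is carried to the upper one by `s ↦ -s`.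
  obtain ⟨C₄, hC₄⟩ := exists_bound_of_bound_on_edges (f := fun s => normRatio A a B b (-s)) hM0 hφ
    (fun s hs => (hd (-s) (by simpa using hs.ne')).comp s (f := fun s => -s) (by fun_prop))
    (fun s h1 h2 => hout (-s) (by simpa using h1.ge) (by simpa using h2.trans (le_abs_self _)))
    (fun s h1 h2 => by
      have := hK (-s) (by simpa using h1) (by simpa using h2.trans (le_abs_self _))
      simpa [abs_of_pos (hφ.trans_le h2)] using this)
  refine ⟨max (max C₁ C₂) (max C₃ C₄), fun s hs => ?_⟩
  rcases le_total M |s.re| with h | h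
  · exact (hout s h hs).trans (le_max_left _ _)
  · refine le_max_of_le_right ?_
    rcases le_abs.1 hs with h2 | h2
    · exact (hC₃ s h h2).trans (le_max_left _ _)
    · have := hC₄ (-s) (by simpa using h) (by simpa using h2)
      rw [neg_neg] at this
      exact this.trans (le_max_right _ _)

/-! ### Deformation of left loops. -/

section Contour

variable {g : ℂ → ℂ} {t C c : ℝ}

lemma integrableOn_horizontal {y : ℝ} (ht : 0 < t)
    (hg : ∀ x : ℝ, ContinuousAt g (x + y * Complex.I))
    (hb : ∀ x : ℝ, x ≤ c → ‖g (x + y * Complex.I)‖ ≤ C * Real.exp (t * x)) :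
    IntegrableOn (fun x : ℝ => g (x + y * Complex.I)) (Iic c) := by
  refine Integrable.mono' ((integrableOn_exp_mul_Iic ht c).const_mul C) ?_ ?_
  · refine (continuous_iff_continuousAt.2 fun x => ?_).aestronglyMeasurable
    exact (hg x).comp (f := fun x : ℝ => (x : ℂ) + y * Complex.I) (by fun_prop)
  · filter_upwards [ae_restrict_mem measurableSet_Iic] with x hx using hb x hx

lemma norm_integral_horizontal_le {y : ℝ} (ht : 0 < t)
    (hb : ∀ x : ℝ, x ≤ c → ‖g (x + y * Complex.I)‖ ≤ C * Real.exp (t * x)) :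
    ‖∫ x in Iic c, g (x + y * Complex.I)‖ ≤ C * (Real.exp (t * c) / t) := by
  rw [← integral_exp_mul_Iic ht c, ← integral_const_mul]
  refine norm_integral_le_of_norm_le ((integrableOn_exp_mul_Iic ht c).const_mul C) ?_
  filter_upwards [ae_restrict_mem measurableSet_Iic] with x hx using hb x hx

/-- **Cauchy's theorem** for a left half-strip. -/
lemma leftLoopIntegral_eq_zero {y₁ y₂ : ℝ} (ht : 0 < t) (hy : y₁ ≤ y₂)
    (hg : ∀ s : ℂ, y₁ ≤ s.im → s.im ≤ y₂ → DifferentiableAt ℂ g s)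
    (hb : ∀ s : ℂ, s.re ≤ c → y₁ ≤ s.im → s.im ≤ y₂ → ‖g s‖ ≤ C * Real.exp (t * s.re)) :
    leftLoopIntegral c y₁ y₂ g = 0 := by
  have hint : ∀ y, y₁ ≤ y → y ≤ y₂ →
      IntegrableOn (fun x : ℝ => g (x + y * Complex.I)) (Iic c) := fun y h1 h2 =>
    integrableOn_horizontal ht (fun x => (hg _ (by simpa using h1) (by simpa using h2)).continuousAt)
      (fun x hx => by
        have := hb (x + y * Complex.I) (by simpa using hx) (by simpa using h1) (by simpa using h2)
        simpa using this)
  have hlim : ∀ y, y₁ ≤ y → y ≤ y₂ →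
      Tendsto (fun R : ℝ => ∫ x in (-R)..c, g (x + y * Complex.I)) atTop
        (𝓝 (∫ x in Iic c, g (x + y * Complex.I))) := fun y h1 h2 =>
    intervalIntegral_tendsto_integral_Iic c (hint y h1 h2) tendsto_neg_atTop_atBot
  have hleft : Tendsto (fun R : ℝ => ∫ y in y₁..y₂, g (((-R : ℝ) : ℂ) + y * Complex.I)) atTop
      (𝓝 0) := by
    have h0 : Tendsto (fun R : ℝ => C * Real.exp (-(t * R)) * |y₂ - y₁|) atTop (𝓝 0) := by
      have h1 := ((Real.tendsto_exp_neg_atTop_nhds_zero.comp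
        (tendsto_id.const_mul_atTop ht)).const_mul C).mul_const |y₂ - y₁|
      simpa using h1
    refine squeeze_zero_norm' ?_ h0
    filter_upwards [eventually_ge_atTop (-c)] with R hR
    refine intervalIntegral.norm_integral_le_of_norm_le_const fun y hy' => ?_
    rw [uIoc_of_le hy] at hy'
    have := hb (((-R : ℝ) : ℂ) + y * Complex.I) (by simp; linarith) (by simpa using hy'.1.le)
      (by simpa using hy'.2)
    simpa using this
  have hrect : ∀ R : ℝ, (∫ x in (-R)..c, g (x + y₁ * Complex.I))
      - (∫ x in (-R)..c, g (x + y₂ * Complex.I))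
      + Complex.I * (∫ y in y₁..y₂, g (c + y * Complex.I))
      - Complex.I * (∫ y in y₁..y₂, g (((-R : ℝ) : ℂ) + y * Complex.I)) = 0 := by
    intro R
    have := Complex.integral_boundary_rect_eq_zero_of_differentiableOn g
      (((-R : ℝ) : ℂ) + y₁ * Complex.I) (c + y₂ * Complex.I) (fun s hs => by
        have h2 := hs.2
        simp only [Complex.add_im, Complex.ofReal_im, Complex.mul_im, Complex.ofReal_re,
          Complex.I_im, Complex.I_re, mul_one, mul_zero, zero_add, add_zero, mem_preimage,
          uIcc_of_le hy] at h2
        exact (hg s h2.1 h2.2).differentiableWithinAt)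
    simpa using this
  have h := (((hlim y₁ le_rfl hy).sub (hlim y₂ hy le_rfl)).add
    (tendsto_const_nhds (x := Complex.I * (∫ y in y₁..y₂, g (c + y * Complex.I))))).sub
    (hleft.const_mul Complex.I)
  have h2 := tendsto_nhds_unique (h.congr hrect) tendsto_const_nhds
  rw [leftLoopIntegral]
  linear_combination h2

/-- The vertical side of a left loop can be moved. -/
lemma leftLoopIntegral_shift {φ₁ φ₂ c' : ℝ} (hφ : φ₁ ≤ φ₂) (hc : c ≤ c')
    (hg : ∀ s : ℂ, c ≤ s.re → φ₁ ≤ s.im → s.im ≤ φ₂ → DifferentiableAt ℂ g s)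
    (h1 : IntegrableOn (fun x : ℝ => g (x + φ₁ * Complex.I)) (Iic c'))
    (h2 : IntegrableOn (fun x : ℝ => g (x + φ₂ * Complex.I)) (Iic c')) :
    leftLoopIntegral c φ₁ φ₂ g = leftLoopIntegral c' φ₁ φ₂ g := by
  have hsub := Iic_subset_Iic.2 hc
  have e1 := intervalIntegral.integral_Iic_sub_Iic (h1.mono_set hsub) h1
  have e2 := intervalIntegral.integral_Iic_sub_Iic (h2.mono_set hsub) h2
  have := Complex.integral_boundary_rect_eq_zero_of_differentiableOn g
    (c + φ₁ * Complex.I) (c' + φ₂ * Complex.I) (fun s hs => by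
      have h1 := hs.1
      have h2 := hs.2
      simp only [Complex.add_im, Complex.ofReal_im, Complex.mul_im, Complex.ofReal_re,
        Complex.I_im, Complex.I_re, mul_one, mul_zero, zero_add, add_zero, mem_preimage,
        uIcc_of_le hφ] at h2
      simp only [Complex.add_re, Complex.ofReal_im, Complex.mul_re, Complex.ofReal_re,
        Complex.I_im, Complex.I_re, mul_one, mul_zero, add_zero, mem_preimage, sub_self,
        uIcc_of_le hc] at h1
      exact (hg s h1.1 h2.1 h2.2).differentiableWithinAt)
  simp only [Complex.add_im, Complex.ofReal_im, Complex.mul_im, Complex.ofReal_re,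
    Complex.I_im, Complex.I_re, mul_one, mul_zero, zero_add, add_zero, Complex.add_re,
    Complex.mul_re, sub_self, smul_eq_mul] at this
  rw [leftLoopIntegral, leftLoopIntegral]
  linear_combination -e1 + e2 - this

/-- A left loop can be opened up to the vertical line through its vertical side. -/
lemma leftLoopIntegral_eq_vertical {φ₁ φ₂ : ℝ} (ht : 0 < t) (h₁ : φ₁ < 0) (h₂ : 0 < φ₂)
    (hg : ∀ s : ℂ, s.im ≠ 0 → DifferentiableAt ℂ g s)
    (hb : ∀ s : ℂ, s.re ≤ c → (s.im ≤ φ₁ ∨ φ₂ ≤ s.im) →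
      ‖g s‖ ≤ C / s.im ^ 2 * Real.exp (t * s.re))
    (hi : Integrable (fun y : ℝ => g (c + y * Complex.I))) :
    leftLoopIntegral c φ₁ φ₂ g = Complex.I * ∫ y : ℝ, g (c + y * Complex.I) := by
  have hC : 0 ≤ C := by
    have := (norm_nonneg _).trans (hb (c + φ₂ * Complex.I) (by simp) (by simp))
    simp at this
    by_contra hneg
    push Not at hneg
    have : C / φ₂ ^ 2 * Real.exp (t * c) < 0 :=
      mul_neg_of_neg_of_pos (div_neg_of_neg_of_pos hneg (by positivity)) (Real.exp_pos _)
    linarith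
  have hvi : ∀ u v : ℝ, IntervalIntegrable (fun y : ℝ => g (c + y * Complex.I)) volume u v :=
    fun u v => hi.intervalIntegrable
  have hU : Tendsto (fun R : ℝ => ∫ x in Iic c, g (x + R * Complex.I)) atTop (𝓝 0) := by
    have h0 : Tendsto (fun R : ℝ => C / R ^ 2 * (Real.exp (t * c) / t)) atTop (𝓝 0) := by
      have := (Tendsto.div_atTop (tendsto_const_nhds (x := C))
        (tendsto_pow_atTop (α := ℝ) two_ne_zero)).mul_const (Real.exp (t * c) / t)
      simpa using this
    refine squeeze_zero_norm' ?_ h0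
    filter_upwards [eventually_ge_atTop φ₂] with R hR
    refine norm_integral_horizontal_le ht fun x hx => ?_
    have := hb (x + R * Complex.I) (by simpa using hx) (Or.inr (by simpa using hR))
    simpa using this
  have hL : Tendsto (fun R : ℝ => ∫ x in Iic c, g (x + (-R : ℝ) * Complex.I)) atTop (𝓝 0) := by
    have h0 : Tendsto (fun R : ℝ => C / R ^ 2 * (Real.exp (t * c) / t)) atTop (𝓝 0) := by
      have := (Tendsto.div_atTop (tendsto_const_nhds (x := C))
        (tendsto_pow_atTop (α := ℝ) two_ne_zero)).mul_const (Real.exp (t * c) / t)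
      simpa using this
    refine squeeze_zero_norm' ?_ h0
    filter_upwards [eventually_ge_atTop (-φ₁)] with R hR
    refine norm_integral_horizontal_le ht fun x hx => ?_
    have := hb (x + (-R : ℝ) * Complex.I) (by simpa using hx) (Or.inl (by simp; linarith))
    simpa using this
  have hV := intervalIntegral_tendsto_integral hi tendsto_neg_atTop_atBot tendsto_id
  -- Two half-strips, above `φ₂` and below `φ₁`, contribute zero each. Adding them moves the
  -- horizontal sides to height `±R`, where the factor `1 / R ^ 2` removes them. The segment of the
  -- real axis left of `c` is never crossed, so `g` may be singular there.
  have hid : ∀ᶠ R : ℝ in atTop, Complex.I * (∫ y in (-R)..(id R), g (c + y * Complex.I))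
      + (∫ x in Iic c, g (x + (-R : ℝ) * Complex.I)) - (∫ x in Iic c, g (x + R * Complex.I))
      = leftLoopIntegral c φ₁ φ₂ g := by
    filter_upwards [eventually_ge_atTop φ₂, eventually_ge_atTop (-φ₁)] with R hR1 hR2
    have u := leftLoopIntegral_eq_zero (g := g) (C := C / φ₂ ^ 2) (c := c) ht hR1
      (fun s h _ => hg s (h₂.trans_le h).ne') (fun s hs h _ => by
        refine (hb s hs (Or.inr h)).trans ?_
        gcongr)
    have l := leftLoopIntegral_eq_zero (g := g) (C := C / φ₁ ^ 2) (c := c) (y₁ := -R) (y₂ := φ₁)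
      ht (by linarith) (fun s _ h => hg s (h.trans_lt h₁).ne) (fun s hs _ h => by
        refine (hb s hs (Or.inl h)).trans ?_
        have : φ₁ ^ 2 ≤ s.im ^ 2 := by nlinarith
        have : 0 < φ₁ ^ 2 := by
          have := h₁.ne
          positivity
        gcongr)
    rw [leftLoopIntegral] at u l
    have e1 := intervalIntegral.integral_add_adjacent_intervals (hvi (-R) φ₁) (hvi φ₁ φ₂)
    have e2 := intervalIntegral.integral_add_adjacent_intervals (hvi (-R) φ₂) (hvi φ₂ R)
    rw [leftLoopIntegral, id, ← e2, ← e1]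
    linear_combination u + l
  have h := ((hV.const_mul Complex.I).add hL).sub hU
  have := tendsto_nhds_unique (h.congr' hid) tendsto_const_nhds
  rw [← this]
  ring

end Contour

/-! ### Differentiation under the loop integral. -/

/-- A general measure lets the horizontal rays and the vertical segment share one argument. For `t₀
/ 2 < t < 2 t₀` and `Re γ ≤ σ` with `σ ≥ 0`, the exponential is dominated by `exp (2 t₀ σ) exp (t₀ /
2 · Re γ)`. -/
lemma hasDerivAt_integral_path {μ : Measure ℝ} {γ : ℝ → ℂ} (hγ : Continuous γ) {f : ℂ → ℂ}
    {σ C : ℝ} (hσ : 0 ≤ σ) (hf : AEStronglyMeasurable (fun x => f (γ x)) μ)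
    (hre : ∀ᵐ x ∂μ, (γ x).re ≤ σ) (hb : ∀ᵐ x ∂μ, ‖f (γ x)‖ ≤ C)
    (hb' : ∀ᵐ x ∂μ, ‖γ x * f (γ x)‖ ≤ C)
    (hint : ∀ t : ℝ, 0 < t → Integrable (fun x => Real.exp (t * (γ x).re)) μ) {t₀ : ℝ}
    (ht₀ : 0 < t₀) :
    HasDerivAt (fun t : ℝ => ∫ x, f (γ x) * Complex.exp (t * γ x) ∂μ)
      (∫ x, γ x * f (γ x) * Complex.exp (t₀ * γ x) ∂μ) t₀ := by
  have hexp : ∀ (t : ℝ) (z : ℂ), ‖Complex.exp (t * z)‖ = Real.exp (t * z.re) := by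
    intro t z; rw [Complex.norm_exp, Complex.re_ofReal_mul]
  refine (hasDerivAt_integral_of_dominated_loc_of_deriv_le (𝕜 := ℝ) (μ := μ)
    (F := fun (t : ℝ) (x : ℝ) => f (γ x) * Complex.exp (t * γ x))
    (F' := fun (t : ℝ) (x : ℝ) => γ x * f (γ x) * Complex.exp (t * γ x))
    (bound := fun x => (|C| * Real.exp ((2 * t₀) * σ)) * (Real.exp (t₀ / 2 * (γ x).re)))
    (s := Ioo (t₀ / 2) (2 * t₀)) (Ioo_mem_nhds (by linarith) (by linarith)) ?_ ?_ ?_ ?_ ?_ ?_).2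
  · exact Eventually.of_forall fun t => hf.mul (by fun_prop : Continuous fun x =>
      Complex.exp (t * γ x)).aestronglyMeasurable
  · refine Integrable.mono' ((hint t₀ ht₀).const_mul C) (hf.mul (by fun_prop : Continuous fun x =>
      Complex.exp (t₀ * γ x)).aestronglyMeasurable) ?_
    filter_upwards [hb] with x hx
    rw [norm_mul, hexp]
    gcongr
  · exact (hγ.aestronglyMeasurable.mul hf).mul (by fun_prop : Continuous fun x =>
      Complex.exp (t₀ * γ x)).aestronglyMeasurable
  · filter_upwards [hre, hb'] with x h1 h2 t ht
    rw [norm_mul, hexp, mul_assoc]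
    refine mul_le_mul (h2.trans (le_abs_self C)) ?_ (Real.exp_pos _).le (abs_nonneg C)
    rw [← Real.exp_add]
    refine Real.exp_le_exp.2 ?_
    nlinarith [ht.1, ht.2, mul_nonneg (sub_nonneg.2 ht.1.le) (sub_nonneg.2 h1),
      mul_nonneg (sub_nonneg.2 ht.2.le) hσ, mul_nonneg ht₀.le hσ]
  · exact ((hint (t₀ / 2) (by linarith)).const_mul _)
  · refine ae_of_all _ fun x t _ => ?_
    have h1 : HasDerivAt (fun t : ℝ => (t : ℂ) * γ x) (1 * γ x) t :=
      (Complex.ofRealCLM.hasDerivAt (x := t)).mul_const (γ x)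
    have h2 := (h1.cexp).const_mul (f (γ x))
    refine h2.congr_deriv ?_
    ring

/-- Differentiation under a left loop integral. -/
lemma hasDerivAt_leftLoopIntegral {f : ℂ → ℂ} {σ φ₁ φ₂ C : ℝ} (hσ : 0 ≤ σ) (hφ : φ₁ ≤ φ₂)
    (hc₁ : ∀ x : ℝ, ContinuousAt f (x + φ₁ * Complex.I))
    (hc₂ : ∀ x : ℝ, ContinuousAt f (x + φ₂ * Complex.I))
    (hcv : ∀ y : ℝ, ContinuousAt f (σ + y * Complex.I))
    (hb : ∀ s : ℂ, s.im = φ₁ ∨ s.im = φ₂ ∨ s.re = σ → ‖f s‖ ≤ C ∧ ‖s * f s‖ ≤ C)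
    {t : ℝ} (ht : 0 < t) :
    HasDerivAt (fun t : ℝ => leftLoopIntegral σ φ₁ φ₂ fun s => f s * Complex.exp (t * s))
      (leftLoopIntegral σ φ₁ φ₂ fun s => s * f s * Complex.exp (t * s)) t := by
  have hor : ∀ φ : ℝ, (∀ x : ℝ, ContinuousAt f (x + φ * Complex.I)) →
      (∀ s : ℂ, s.im = φ → ‖f s‖ ≤ C ∧ ‖s * f s‖ ≤ C) →
      HasDerivAt (fun t : ℝ => ∫ x in Iic σ, f (x + φ * Complex.I)
        * Complex.exp (t * (x + φ * Complex.I)))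
        (∫ x in Iic σ, ((x : ℂ) + φ * Complex.I) * f (x + φ * Complex.I)
        * Complex.exp (t * (x + φ * Complex.I))) t := by
    intro φ h1 h2
    refine hasDerivAt_integral_path (μ := volume.restrict (Iic σ))
      (γ := fun x : ℝ => (x : ℂ) + φ * Complex.I) (by fun_prop) hσ (C := C) ?_ ?_ ?_ ?_ ?_ ht
    · exact (continuous_iff_continuousAt.2 fun x => (h1 x).comp
        (f := fun x : ℝ => (x : ℂ) + φ * Complex.I) (by fun_prop)).aestronglyMeasurable
    · filter_upwards [ae_restrict_mem measurableSet_Iic] with x hx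
      simpa using hx
    · exact ae_of_all _ fun x => (h2 _ (by simp)).1
    · exact ae_of_all _ fun x => (h2 _ (by simp)).2
    · intro t ht
      have := integrableOn_exp_mul_Iic ht σ
      rw [IntegrableOn] at this
      simpa using this
  have ver : HasDerivAt (fun t : ℝ => ∫ y in φ₁..φ₂, f (σ + y * Complex.I)
        * Complex.exp (t * (σ + y * Complex.I)))
        (∫ y in φ₁..φ₂, ((σ : ℂ) + y * Complex.I) * f (σ + y * Complex.I)
        * Complex.exp (t * (σ + y * Complex.I))) t := by
    simp only [intervalIntegral.integral_of_le hφ]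
    refine hasDerivAt_integral_path (μ := volume.restrict (Ioc φ₁ φ₂))
      (γ := fun y : ℝ => (σ : ℂ) + y * Complex.I) (by fun_prop) hσ (C := C) ?_ ?_ ?_ ?_ ?_ ht
    · exact (continuous_iff_continuousAt.2 fun x => (hcv x).comp
        (f := fun y : ℝ => (σ : ℂ) + y * Complex.I) (by fun_prop)).aestronglyMeasurable
    · exact ae_of_all _ fun x => by simp
    · exact ae_of_all _ fun x => (hb _ (by simp)).1
    · exact ae_of_all _ fun x => (hb _ (by simp)).2
    · intro t ht
      simp
  exact ((hor φ₁ hc₁ fun s hs => hb s (Or.inl hs)).fun_add (ver.const_mul Complex.I)).fun_sub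
    (hor φ₂ hc₂ fun s hs => hb s (Or.inr (Or.inl hs)))

/-! ### The second antiderivative and its Fourier inversion. -/

lemma ExpBounded.lap_add {m : ℝ} {f g : ℝ → ℝ} (hf : ExpBounded m f) (hg : ExpBounded m g)
    {s : ℂ} (hs : m < s.re) : lap (fun t => f t + g t) s = lap f s + lap g s := by
  rw [lap, lap, lap, ← integral_add (hf.integrableOn_lap hs) (hg.integrableOn_lap hs)]
  simp only [Complex.ofReal_add, add_mul]

lemma lap_const_mul (c : ℝ) (f : ℝ → ℝ) (s : ℂ) : lap (fun t => c * f t) s = c * lap f s := by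
  simp only [lap, Complex.ofReal_mul, mul_assoc, integral_const_mul]

lemma expBounded_one : ExpBounded 0 (fun _ => 1) :=
  ⟨continuousOn_const, 1, fun t _ => by simp⟩

lemma expBounded_id {m : ℝ} (hm : 0 < m) : ExpBounded m (fun t => t) := by
  simpa using expBounded_one.id_mul hm

lemma lap_one {s : ℂ} (hs : 0 < s.re) : lap (fun _ => 1) s = 1 / s := by
  simp only [lap, Complex.ofReal_one, one_mul]
  rw [integral_exp_mul_complex_Ioi (by simpa using hs)]
  simp

lemma lap_id {s : ℂ} (hs : 0 < s.re) : lap (fun t => t) s = 1 / s ^ 2 := by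
  have hs0 : s ≠ 0 := by rintro rfl; simp at hs
  have h1 := expBounded_one.hasDerivAt_lap hs
  have h2 : HasDerivAt (lap fun _ => 1) (-(1 / s ^ 2)) s := by
    have := hasDerivAt_inv hs0
    rw [← one_div] at this
    refine this.congr_of_eventuallyEq ?_
    filter_upwards [(isOpen_lt continuous_const Complex.continuous_re).mem_nhds hs] with z hz
    rw [lap_one hz, one_div]
  have h3 := h1.unique h2
  simp only [mul_one] at h3
  exact neg_injective h3

/-- The second antiderivative of `ν δ₀ + h`. -/
noncomputable def secondPrimitive (ν : ℝ) (h : ℝ → ℝ) (t : ℝ) : ℝ :=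
  ν * t + ∫ u in (0 : ℝ)..t, h u * (t - u)

section

variable {h : ℝ → ℝ} {ν σ : ℝ}

lemma hasDerivAt_secondPrimitive (hc : Continuous h) (t : ℝ) :
    HasDerivAt (secondPrimitive ν h) (ν + ∫ u in (0 : ℝ)..t, h u) t := by
  have hi : ∀ f : ℝ → ℝ, Continuous f → ∀ t : ℝ, HasDerivAt (fun t => ∫ u in (0 : ℝ)..t, f u)
      (f t) t := fun f hf t => intervalIntegral.integral_hasDerivAt_right
    (hf.intervalIntegrable _ _) (hf.stronglyMeasurableAtFilter _ _) hf.continuousAt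
  have e : secondPrimitive ν h = fun t => ν * t + (t * (∫ u in (0 : ℝ)..t, h u)
      - ∫ u in (0 : ℝ)..t, u * h u) := by
    ext t
    rw [secondPrimitive, ← intervalIntegral.integral_const_mul, ← intervalIntegral.integral_sub
      ((by fun_prop : Continuous fun u => t * h u).intervalIntegrable _ _)
      ((by fun_prop : Continuous fun u => u * h u).intervalIntegrable _ _)]
    congr 2
    ext u
    ring
  rw [e]
  have h1 := ((hasDerivAt_id t).const_mul ν).fun_add
    (((hasDerivAt_id t).fun_mul (hi h hc t)).fun_sub
      (hi (fun u => u * h u) (by fun_prop) t))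
  refine h1.congr_deriv ?_
  simp

lemma hasDerivAt_primitive (hc : Continuous h) (t : ℝ) :
    HasDerivAt (fun t => ν + ∫ u in (0 : ℝ)..t, h u) (h t) t :=
  (intervalIntegral.integral_hasDerivAt_right (hc.intervalIntegrable _ _)
    (hc.stronglyMeasurableAtFilter _ _) hc.continuousAt).const_add ν

lemma continuous_secondPrimitive (hc : Continuous h) : Continuous (secondPrimitive ν h) :=
  continuous_iff_continuousAt.2 fun t => (hasDerivAt_secondPrimitive hc t).continuousAt

lemma expBounded_convolution_id (hc : Continuous h) (hh : ExpBounded σ h) (hσ : 0 < σ) {σ' : ℝ}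
    (hσ' : σ < σ') : ExpBounded σ' (fun t => ∫ u in (0 : ℝ)..t, h u * (t - u)) := by
  obtain ⟨C, hC0, hC⟩ := hh.exists_nonneg
  obtain ⟨τ, hτ, hτ'⟩ := exists_between hσ'
  have hE : ExpBounded σ (fun t => C * Real.exp (σ * t)) :=
    ⟨by fun_prop, C, fun t _ => by rw [abs_of_nonneg (by positivity)]⟩
  obtain ⟨D, hD⟩ := ((hE.id_mul hτ).id_mul hτ').bound
  refine ⟨?_, D, fun t ht => le_trans ?_ (hD t ht)⟩
  · have := continuous_secondPrimitive (ν := 0) hc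
    simp only [zero_mul, zero_add,
      show secondPrimitive 0 h = fun t => 0 * t + ∫ u in (0 : ℝ)..t, h u * (t - u) from rfl]
      at this
    exact this.continuousOn
  · have := intervalIntegral.norm_integral_le_of_norm_le_const (a := (0 : ℝ)) (b := t)
      (C := C * Real.exp (σ * t) * t) (f := fun u => h u * (t - u)) (fun u hu => by
        rw [uIoc_of_le ht.le] at hu
        rw [norm_mul]
        refine mul_le_mul ((hC u hu.1).trans ?_) ?_ (norm_nonneg _) (by positivity)
        · have := hu.2
          gcongr
        · rw [Real.norm_eq_abs, abs_of_nonneg (by linarith [hu.2])]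
          linarith [hu.1])
    rw [sub_zero, abs_of_pos ht, Real.norm_eq_abs] at this
    refine this.trans_eq ?_
    rw [abs_of_nonneg (by positivity)]
    ring

lemma expBounded_secondPrimitive (hc : Continuous h) (hh : ExpBounded σ h) (hσ : 0 < σ) {σ' : ℝ}
    (hσ' : σ < σ') : ExpBounded σ' (secondPrimitive ν h) :=
  ((expBounded_id (hσ.trans hσ')).const_mul ν).add (expBounded_convolution_id hc hh hσ hσ')

/-- The integral is the convolution of `h` with `t`, whose transform is `1 / s ^ 2`. This factor
gives the decay on vertical lines that inversion needs. -/
lemma lap_secondPrimitive (hc : Continuous h) (hh : ExpBounded σ h) (hσ : 0 < σ) {s : ℂ}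
    (hs : σ < s.re) : lap (secondPrimitive ν h) s = (ν + lap h s) / s ^ 2 := by
  obtain ⟨τ, hτ, hτ'⟩ := exists_between hs
  have h1 := ((expBounded_id (hσ.trans hτ)).const_mul ν).lap_add
    (expBounded_convolution_id hc hh hσ hτ) hτ'
  have h2 := hh.lap_convolution (expBounded_id hσ) hs
  rw [lap_const_mul, h2, lap_id (hσ.trans hs)] at h1
  refine Eq.trans h1 ?_
  ring

/-- Fourier inversion for the second antiderivative. -/
lemma secondPrimitive_eq_integral (hc : Continuous h) (hh : ExpBounded σ h) (hσ : 0 < σ) {c : ℝ}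
    (hcσ : σ < c) {G : ℂ → ℂ} (hG : ∀ s : ℂ, σ < s.re → G s = ν + lap h s)
    (hi : Integrable fun y : ℝ => G (c + y * Complex.I) / (c + y * Complex.I) ^ 2)
    {t : ℝ} (ht : 0 < t) :
    (secondPrimitive ν h t : ℂ) = 1 / (2 * Real.pi) * ∫ y : ℝ,
      G (c + y * Complex.I) / (c + y * Complex.I) ^ 2 * Complex.exp (t * (c + y * Complex.I)) := by
  set w := secondPrimitive ν h with hw
  obtain ⟨τ, hτ, hτc⟩ := exists_between hcσ
  have hwb : ExpBounded τ w := expBounded_secondPrimitive hc hh hσ hτ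
  have hpi := Real.pi_pos
  -- Damping by `exp (-c t)` and cutting off at `0` makes the Laplace transform on `Re s = c` a
  -- Fourier transform, with `s = c + 2 π ξ i`.
  set f : ℝ → ℂ := indicator (Ioi 0) (fun t => (w t : ℂ) * Complex.exp (-(c : ℂ) * t)) with hf
  have hfi : Integrable f := by
    rw [hf, integrable_indicator_iff measurableSet_Ioi]
    exact hwb.integrableOn_lap (by simpa using hτc)
  have hF : 𝓕 f = fun ξ : ℝ => G (c + (2 * Real.pi * ξ : ℝ) * Complex.I)
      / (c + (2 * Real.pi * ξ : ℝ) * Complex.I) ^ 2 := by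
    ext ξ
    have hre : σ < ((c : ℂ) + (2 * Real.pi * ξ : ℝ) * Complex.I).re := by simpa using hcσ
    rw [Real.fourier_real_eq_integral_exp_smul, hG _ hre, ← lap_secondPrimitive hc hh hσ hre, lap,
      ← integral_indicator measurableSet_Ioi]
    congr 1
    ext v
    by_cases hv : v ∈ Ioi (0 : ℝ)
    · rw [hf, indicator_of_mem hv, indicator_of_mem hv, smul_eq_mul, mul_left_comm,
        ← Complex.exp_add]
      congr 2
      push_cast
      ring
    · rw [hf, indicator_of_notMem hv, indicator_of_notMem hv, smul_zero]
  have hFi : Integrable (𝓕 f) := by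
    rw [hF]
    exact hi.comp_mul_left' (by positivity)
  have hcont : ContinuousAt f t := by
    have h1 : ContinuousAt (fun t : ℝ => (w t : ℂ) * Complex.exp (-(c : ℂ) * t)) t := by
      have := continuous_secondPrimitive (ν := ν) hc
      rw [← hw] at this
      fun_prop
    refine h1.congr ?_
    filter_upwards [isOpen_Ioi.mem_nhds ht] with u hu
    rw [hf, indicator_of_mem hu]
  have hinv := hfi.fourierInv_fourier_eq hFi hcont
  rw [Real.fourierInv_eq', hF, hf, indicator_of_mem (show t ∈ Ioi (0 : ℝ) from ht)] at hinv
  have hsub := Measure.integral_comp_mul_left (fun y : ℝ =>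
    G (c + y * Complex.I) / (c + y * Complex.I) ^ 2 * Complex.exp (t * (c + y * Complex.I)))
    (2 * Real.pi)
  rw [abs_of_pos (by positivity), Complex.real_smul] at hsub
  have h3 : (1 / (2 * Real.pi) : ℂ) = (((2 * Real.pi)⁻¹ : ℝ) : ℂ) := by push_cast; ring
  rw [h3, ← hsub]
  have h4 : (w t : ℂ) = Complex.exp (c * t) * ((w t : ℂ) * Complex.exp (-(c : ℂ) * t)) := by
    rw [mul_left_comm, ← Complex.exp_add]
    simp
  rw [h4, ← hinv, ← integral_const_mul]
  congr 1
  ext ξ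
  simp only [RCLike.inner_apply, conj_trivial, smul_eq_mul]
  rw [show (t : ℂ) * (c + (2 * Real.pi * ξ : ℝ) * Complex.I)
    = c * t + ((2 * Real.pi * (t * ξ) : ℝ) : ℂ) * Complex.I by push_cast; ring, Complex.exp_add]
  ring

end

/-! ### Fox's function as the solution of the Volterra equation. -/

lemma leftLoopIntegral_congr {c φ₁ φ₂ : ℝ} {f g : ℂ → ℂ}
    (h : ∀ s : ℂ, s.im = φ₁ ∨ s.im = φ₂ ∨ s.re = c → f s = g s) :
    leftLoopIntegral c φ₁ φ₂ f = leftLoopIntegral c φ₁ φ₂ g := by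
  have h1 : ∀ x : ℝ, f (x + φ₁ * Complex.I) = g (x + φ₁ * Complex.I) := fun x => h _ (by simp)
  have h2 : ∀ x : ℝ, f (x + φ₂ * Complex.I) = g (x + φ₂ * Complex.I) := fun x => h _ (by simp)
  have h3 : ∀ y : ℝ, f (c + y * Complex.I) = g (c + y * Complex.I) := fun y => h _ (by simp)
  simp only [leftLoopIntegral, h1, h2, h3]

lemma integrand_eq {A : Fin p → ℝ} (a : Fin p → ℝ) {B : Fin q → ℝ} (b : Fin q → ℝ)
    (hA : ∀ k, 0 < A k) (hB : ∀ j, 0 < B j) {x : ℝ} (hx : 0 < x) :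
    integrand A a B b x
      = fun s => normRatio A a B b s * Complex.exp ((Real.log (rho A B / x) : ℝ) * s) := by
  ext s
  rw [integrand, normRatio_eq_mul_exp hA hB, Complex.cpow_def_of_ne_zero (by exact_mod_cast hx.ne'),
    ← Complex.ofReal_log hx.le, mul_assoc, ← Complex.exp_add,
    Real.log_div (rho_pos hA hB).ne' hx.ne']
  congr 2
  push_cast
  ring

/-- A left loop integral of `G exp (t s)` equals the function whose second antiderivative has
Laplace transform `G / s ^ 2`. -/
lemma leftLoopIntegral_mul_exp {G : ℂ → ℂ} {h : ℝ → ℝ} {ν σ c φ₁ φ₂ C : ℝ}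
    (hc : Continuous h) (hh : ExpBounded σ h) (hσ : 0 < σ) (hcσ : σ < c)
    (hG : ∀ s : ℂ, σ < s.re → G s = ν + lap h s)
    (h₁ : φ₁ < 0) (h₂ : 0 < φ₂) (hd : ∀ s : ℂ, s.im ≠ 0 → DifferentiableAt ℂ G s)
    (hb : ∀ s : ℂ, s.im ≤ φ₁ ∨ φ₂ ≤ s.im ∨ s.re = c → ‖G s‖ ≤ C) {t : ℝ} (ht : 0 < t) :
    leftLoopIntegral c φ₁ φ₂ (fun s => G s * Complex.exp (t * s))
      = 2 * Real.pi * Complex.I * h t := by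
  have hc0 : 0 < c := hσ.trans hcσ
  have hC : 0 ≤ C := (norm_nonneg _).trans (hb (c : ℂ) (by simp))
  have hdv : ∀ s : ℂ, s.re = c → DifferentiableAt ℂ G s := by
    intro s hs
    have h1 : DifferentiableAt ℂ (fun s => ν + lap h s) s :=
      ((hh.hasDerivAt_lap (by rw [hs]; exact hcσ)).const_add _).differentiableAt
    refine h1.congr_of_eventuallyEq ?_
    filter_upwards [(isOpen_lt continuous_const Complex.continuous_re).mem_nhds
      (show σ < s.re by rw [hs]; exact hcσ)] with z hz using hG z hz
  have hne_im : ∀ s : ℂ, s.im ≠ 0 → s ≠ 0 := by rintro s hs rfl; exact hs rfl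
  have hne_re : ∀ s : ℂ, s.re = c → s ≠ 0 := by
    rintro s hs rfl
    exact hc0.ne hs
  set f : ℂ → ℂ := fun s => G s / s ^ 2 with hf
  have hfd : ∀ s : ℂ, s.im ≠ 0 ∨ s.re = c → DifferentiableAt ℂ f s := by
    rintro s (hs | hs)
    · exact (hd s hs).div (by fun_prop) (pow_ne_zero 2 (hne_im s hs))
    · exact (hdv s hs).div (by fun_prop) (pow_ne_zero 2 (hne_re s hs))
  -- A lower bound for the distance from the loop to `0`, where dividing by `s ^ 2` creates a pole.
  set δ := min (min (-φ₁) φ₂) c with hδ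
  have hδ0 : 0 < δ := lt_min (lt_min (by linarith) h₂) hc0
  have hloop : ∀ s : ℂ, s.im = φ₁ ∨ s.im = φ₂ ∨ s.re = c → δ ≤ ‖s‖ ∧ ‖G s‖ ≤ C := by
    rintro s (hs | hs | hs)
    · refine ⟨le_trans ?_ (Complex.abs_im_le_norm s), hb s (Or.inl hs.le)⟩
      rw [hs, abs_of_neg h₁]
      exact (min_le_left _ _).trans (min_le_left _ _)
    · refine ⟨le_trans ?_ (Complex.abs_im_le_norm s), hb s (Or.inr (Or.inl hs.ge))⟩
      rw [hs, abs_of_pos h₂]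
      exact (min_le_left _ _).trans (min_le_right _ _)
    · refine ⟨le_trans ?_ (Complex.abs_re_le_norm s), hb s (Or.inr (Or.inr hs))⟩
      rw [hs, abs_of_pos hc0]
      exact min_le_right _ _
  have hloop_ne : ∀ s : ℂ, s.im = φ₁ ∨ s.im = φ₂ ∨ s.re = c → s ≠ 0 := by
    intro s hs h0
    have := (hloop s hs).1
    rw [h0, norm_zero] at this
    linarith
  have hvi : Integrable fun y : ℝ => G (c + y * Complex.I) / (c + y * Complex.I) ^ 2 := by
    have hk : 0 < min 1 (c ^ 2) := lt_min one_pos (by positivity)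
    refine Integrable.mono' (integrable_inv_one_add_sq.const_mul (C / min 1 (c ^ 2))) ?_
      (ae_of_all _ fun y => ?_)
    · refine (continuous_iff_continuousAt.2 fun y => ?_).aestronglyMeasurable
      exact (hfd _ (Or.inr (by simp))).continuousAt.comp
        (f := fun y : ℝ => (c : ℂ) + y * Complex.I) (by fun_prop)
    · have h3 : ‖(c : ℂ) + y * Complex.I‖ ^ 2 = c ^ 2 + y ^ 2 := by
        rw [← Complex.normSq_eq_norm_sq, Complex.normSq_apply]
        simp
        ring
      rw [norm_div, norm_pow, h3, ← div_eq_mul_inv, div_div]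
      have h4 : min 1 (c ^ 2) * (1 + y ^ 2) ≤ c ^ 2 + y ^ 2 := by
        have e1 := min_le_left 1 (c ^ 2)
        have e2 := min_le_right 1 (c ^ 2)
        nlinarith [mul_le_mul_of_nonneg_right e1 (sq_nonneg y)]
      have := hb (c + y * Complex.I) (by simp)
      gcongr
  have hprim : ∀ u : ℝ, 0 < u → leftLoopIntegral c φ₁ φ₂ (fun s => f s * Complex.exp (u * s))
      = 2 * Real.pi * Complex.I * secondPrimitive ν h u := by
    intro u hu
    rw [secondPrimitive_eq_integral hc hh hσ hcσ hG hvi hu,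
      leftLoopIntegral_eq_vertical (g := fun s => f s * Complex.exp (u * s)) (t := u) (C := C)
        hu h₁ h₂]
    · have hpi : (Real.pi : ℂ) ≠ 0 := by exact_mod_cast Real.pi_pos.ne'
      have e : 2 * (Real.pi : ℂ) * Complex.I * (1 / (2 * Real.pi)) = Complex.I := by field_simp
      simp only [hf]
      rw [← mul_assoc, e]
    · exact fun s hs => (hfd s (Or.inl hs)).mul (by fun_prop)
    · intro s hs hsi
      have hs0 : s.im ≠ 0 := hsi.elim (fun h => (h.trans_lt h₁).ne) fun h => (h₂.trans_le h).ne'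
      have h3 : s.im ^ 2 ≤ ‖s‖ ^ 2 := by
        rw [← sq_abs s.im]
        exact pow_le_pow_left₀ (abs_nonneg _) (Complex.abs_im_le_norm s) 2
      have h4 : ‖G s‖ ≤ C := hb s (by tauto)
      rw [norm_mul, Complex.norm_exp, Complex.re_ofReal_mul, hf, norm_div, norm_pow]
      have : 0 < s.im ^ 2 := by positivity
      gcongr
    · refine (hvi.norm.mul_const (Real.exp (u * c))).mono' ?_ (ae_of_all _ fun y => ?_)
      · refine hvi.aestronglyMeasurable.mul (Continuous.aestronglyMeasurable ?_)
        fun_prop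
      · rw [norm_mul, Complex.norm_exp, Complex.re_ofReal_mul]
        simp [hf]
  set C' := C + C / δ + C / δ ^ 2 with hC'
  have hbd : ∀ s : ℂ, s.im = φ₁ ∨ s.im = φ₂ ∨ s.re = c →
      ‖f s‖ ≤ C' ∧ ‖s * f s‖ ≤ C' ∧ ‖s * (s * f s)‖ ≤ C' := by
    intro s hs
    obtain ⟨h3, h4⟩ := hloop s hs
    have hs0 := hloop_ne s hs
    have p1 : 0 ≤ C / δ := by positivity
    have p2 : 0 ≤ C / δ ^ 2 := by positivity
    have e1 : s * f s = G s / s := by rw [hf]; field_simp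
    have e2 : s * (s * f s) = G s := by rw [hf]; field_simp
    rw [e2, e1, hf, norm_div, norm_div, norm_pow]
    refine ⟨?_, ?_, by linarith⟩
    · have : ‖G s‖ / ‖s‖ ^ 2 ≤ C / δ ^ 2 := by gcongr
      linarith
    · have : ‖G s‖ / ‖s‖ ≤ C / δ := by gcongr
      linarith
  -- Each derivative in `u` multiplies the integrand by `s`, so two of them restore `G`. On the
  -- other side they turn `secondPrimitive` into `h`.
  have hd1 : ∀ u : ℝ, 0 < u → HasDerivAt
      (fun u : ℝ => leftLoopIntegral c φ₁ φ₂ fun s => f s * Complex.exp (u * s))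
      (leftLoopIntegral c φ₁ φ₂ fun s => s * f s * Complex.exp (u * s)) u := fun u hu =>
    hasDerivAt_leftLoopIntegral hc0.le (by linarith)
      (fun x => (hfd _ (Or.inl (by simpa using h₁.ne))).continuousAt)
      (fun x => (hfd _ (Or.inl (by simpa using h₂.ne'))).continuousAt)
      (fun y => (hfd _ (Or.inr (by simp))).continuousAt)
      (fun s hs => ⟨(hbd s hs).1, (hbd s hs).2.1⟩) hu
  have hd2 : HasDerivAt
      (fun u : ℝ => leftLoopIntegral c φ₁ φ₂ fun s => s * f s * Complex.exp (u * s))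
      (leftLoopIntegral c φ₁ φ₂ fun s => s * (s * f s) * Complex.exp (t * s)) t :=
    hasDerivAt_leftLoopIntegral hc0.le (by linarith)
      (fun x => (differentiableAt_id.mul (hfd _ (Or.inl (by simpa using h₁.ne)))).continuousAt)
      (fun x => (differentiableAt_id.mul (hfd _ (Or.inl (by simpa using h₂.ne')))).continuousAt)
      (fun y => (differentiableAt_id.mul (hfd _ (Or.inr (by simp)))).continuousAt)
      (fun s hs => (hbd s hs).2) ht
  have hfirst : ∀ u : ℝ, 0 < u →
      leftLoopIntegral c φ₁ φ₂ (fun s => s * f s * Complex.exp (u * s))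
        = 2 * Real.pi * Complex.I * ((ν + ∫ v in (0 : ℝ)..u, h v : ℝ) : ℂ) := by
    intro u hu
    have h3 := (hasDerivAt_secondPrimitive (ν := ν) hc u).ofReal_comp.const_mul
      (2 * Real.pi * Complex.I)
    refine (hd1 u hu).unique (h3.congr_of_eventuallyEq ?_)
    filter_upwards [isOpen_Ioi.mem_nhds hu] with v hv using hprim v hv
  have hsecond : leftLoopIntegral c φ₁ φ₂ (fun s => s * (s * f s) * Complex.exp (t * s))
      = 2 * Real.pi * Complex.I * h t := by
    have h3 := (hasDerivAt_primitive (ν := ν) hc t).ofReal_comp.const_mul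
      (2 * Real.pi * Complex.I)
    refine hd2.unique (h3.congr_of_eventuallyEq ?_)
    filter_upwards [isOpen_Ioi.mem_nhds ht] with v hv using hfirst v hv
  rw [← hsecond]
  refine leftLoopIntegral_congr fun s hs => ?_
  have := hloop_ne s hs
  simp only [hf]
  field_simp

/-- Fox's function is a solution of the Volterra equation, in the variable `log (rho / x)`. -/
theorem exists_foxH_eq {A a : Fin p → ℝ} {B b : Fin q → ℝ} (hA : ∀ k, 0 < A k)
    (hB : ∀ j, 0 < B j) (hmu : mu a b = 0) (hDelta : ∑ j, B j - ∑ k, A k = 0) {c φ₁ φ₂ : ℝ}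
    (hloop : IsAdmissibleLoop A a c φ₁ φ₂) :
    ∃ h : ℝ → ℝ, Continuous h ∧
      (∀ t, 0 < t → t * h t = nu A a B b * (t * kern A a B b t)
        + ∫ w in (0 : ℝ)..t, h w * ((t - w) * kern A a B b (t - w))) ∧
      ∀ x ∈ Ioo 0 (rho A B), LeftLoopIntegrable c φ₁ φ₂ (integrand A a B b x) ∧
        foxH A a B b c φ₁ φ₂ x = h (Real.log (rho A B / x)) := by
  obtain ⟨h₁, h₂, hpole⟩ := hloop
  obtain ⟨σ, hσ, h, hhc, hh, heq, hG⟩ := exists_normRatio_eq hA hB hmu hDelta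
  refine ⟨h, hhc, heq, fun x hx => ?_⟩
  have hd : ∀ s : ℂ, s.im ≠ 0 → DifferentiableAt ℂ (normRatio A a B b) s := fun s hs =>
    differentiableAt_normRatio hA hB (differentiableAt_gammaRatio_of_im_ne_zero hA hs)
  have hdr : ∀ s : ℂ, c ≤ s.re → DifferentiableAt ℂ (normRatio A a B b) s := fun s hs =>
    differentiableAt_normRatio hA hB
      (differentiableAt_gammaRatio_of_lt_re hA fun k => (hpole k).trans_le hs)
  obtain ⟨C₁, hC₁⟩ := exists_norm_normRatio_le hA hB hmu hDelta (lt_min (neg_pos.2 h₁) h₂)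
  obtain ⟨C₂, hC₂0, hC₂⟩ := hh.norm_lap_le
  -- The vertical side is moved right, to where `normRatio` is known to be `ν + L h`; no pole lies
  -- between, since all are left of `c`.
  set c' := max c (σ + 1) with hc'
  have hcc' : c ≤ c' := le_max_left _ _
  have hσc' : σ + 1 ≤ c' := le_max_right _ _
  have hb1 : ∀ s : ℂ, s.im ≤ φ₁ ∨ φ₂ ≤ s.im → ‖normRatio A a B b s‖ ≤ C₁ := by
    rintro s (hs | hs)
    · exact hC₁ s ((min_le_left _ _).trans (by linarith [neg_le_abs s.im]))
    · exact hC₁ s ((min_le_right _ _).trans (by linarith [le_abs_self s.im]))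
  have hb : ∀ s : ℂ, s.im ≤ φ₁ ∨ φ₂ ≤ s.im ∨ s.re = c' →
      ‖normRatio A a B b s‖ ≤ max C₁ (‖(nu A a B b : ℂ)‖ + C₂) := by
    rintro s (hs | hs | hs)
    · exact (hb1 s (Or.inl hs)).trans (le_max_left _ _)
    · exact (hb1 s (Or.inr hs)).trans (le_max_left _ _)
    · rw [hG s (by linarith)]
      refine ((norm_add_le _ _).trans (add_le_add le_rfl ((hC₂ s (by linarith)).trans ?_))).trans
        (le_max_right _ _)
      exact div_le_self hC₂0 (by linarith)
  set t := Real.log (rho A B / x) with ht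
  have ht0 : 0 < t := Real.log_pos ((one_lt_div hx.1).2 hx.2)
  rw [foxH, integrand_eq a b hA hB hx.1]
  set g : ℂ → ℂ := fun s => normRatio A a B b s * Complex.exp ((t : ℂ) * s) with hg
  have hgd : ∀ s : ℂ, s.im ≠ 0 → DifferentiableAt ℂ g s := fun s hs =>
    (hd s hs).mul (by fun_prop)
  have hgdr : ∀ s : ℂ, c ≤ s.re → DifferentiableAt ℂ g s := fun s hs =>
    (hdr s hs).mul (by fun_prop)
  have hgb : ∀ s : ℂ, s.im ≤ φ₁ ∨ φ₂ ≤ s.im → ‖g s‖ ≤ C₁ * Real.exp (t * s.re) := by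
    intro s hs
    rw [hg, norm_mul, Complex.norm_exp, Complex.re_ofReal_mul]
    exact mul_le_mul_of_nonneg_right (hb1 s hs) (Real.exp_pos _).le
  have i1 : ∀ d : ℝ, IntegrableOn (fun x : ℝ => g (x + φ₁ * Complex.I)) (Iic d) := fun d =>
    integrableOn_horizontal (C := C₁) ht0
      (fun x => (hgd _ (by simpa using h₁.ne)).continuousAt) (fun x _ => by
        simpa using hgb (x + φ₁ * Complex.I) (Or.inl (by simp)))
  have i2 : ∀ d : ℝ, IntegrableOn (fun x : ℝ => g (x + φ₂ * Complex.I)) (Iic d) := fun d =>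
    integrableOn_horizontal (C := C₁) ht0
      (fun x => (hgd _ (by simpa using h₂.ne')).continuousAt) (fun x _ => by
        simpa using hgb (x + φ₂ * Complex.I) (Or.inr (by simp)))
  refine ⟨⟨i1 c, ?_, i2 c⟩, ?_⟩
  · refine (continuous_iff_continuousAt.2 fun y => ?_).intervalIntegrable _ _
    exact (hgdr _ (by simp)).continuousAt.comp
      (f := fun y : ℝ => (c : ℂ) + y * Complex.I) (by fun_prop)
  · rw [leftLoopIntegral_shift (by linarith) hcc' (fun s hs _ _ => hgdr s hs) (i1 c') (i2 c'),
      leftLoopIntegral_mul_exp hhc hh hσ (by linarith) hG h₁ h₂ hd hb ht0]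
    have : (Real.pi : ℂ) ≠ 0 := by exact_mod_cast Real.pi_pos.ne'
    field_simp [Complex.I_ne_zero]

/-! ### The integral formula in the original variable. -/

lemma Q_div_eq {A a : Fin p → ℝ} {B b : Fin q → ℝ} (hA : ∀ k, 0 < A k) (hB : ∀ j, 0 < B j)
    (hmu : mu a b = 0) (hDelta : ∑ j, B j - ∑ k, A k = 0) {x u : ℝ} (hx : 0 < x) (hu : x < u) :
    Q A a B b (x / u) = Real.log (u / x) * kern A a B b (Real.log (u / x)) := by
  have hu0 : 0 < u := hx.trans hu
  rw [mul_kern hA hB hmu hDelta (Real.log_pos ((one_lt_div hx).2 hu)), ← Real.log_inv, inv_div,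
    Real.exp_log (div_pos hx hu0)]

end FoxH

theorem corollary3p1 {p q : ℕ} (A a : Fin p → ℝ) (B b : Fin q → ℝ)
    (hA : ∀ k, 0 < A k) (hB : ∀ j, 0 < B j)
    (ha : ∀ k, 0 ≤ a k) (hb : ∀ j, 0 ≤ b j)
    (hmu : FoxH.mu a b = 0) (hrho : FoxH.rho A B ≤ 1)
    (hDelta : ∑ j, B j - ∑ k, A k = 0)
    (c φ₁ φ₂ : ℝ) (hloop : FoxH.IsAdmissibleLoop A a c φ₁ φ₂)
    (x : ℝ) (hx : x ∈ Set.Ioo 0 (FoxH.rho A B)) :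
    FoxH.LeftLoopIntegrable c φ₁ φ₂ (FoxH.integrand A a B b x) ∧
    IntervalIntegrable
      (fun u : ℝ => FoxH.foxH A a B b c φ₁ φ₂ u * ((FoxH.Q A a B b (x / u) / u : ℝ) : ℂ))
      MeasureTheory.volume x (FoxH.rho A B) ∧
    FoxH.foxH A a B b c φ₁ φ₂ x =
      1 / ((Real.log (FoxH.rho A B / x) : ℝ) : ℂ) *
        (((FoxH.nu A a B b * FoxH.Q A a B b (x / FoxH.rho A B) : ℝ) : ℂ) +
          ∫ u in x..(FoxH.rho A B),
            FoxH.foxH A a B b c φ₁ φ₂ u * ((FoxH.Q A a B b (x / u) / u : ℝ) : ℂ)) := by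
  obtain ⟨h, hhc, heq, hfox⟩ := FoxH.exists_foxH_eq hA hB hmu hDelta hloop
  set r := FoxH.rho A B with hr
  have hx0 : 0 < x := hx.1
  have hxr : x < r := hx.2
  have hr0 : 0 < r := hx0.trans hxr
  set T := Real.log (r / x) with hT
  have hT0 : 0 < T := Real.log_pos ((one_lt_div hx0).2 hxr)
  set κ := FoxH.kern A a B b with hκ
  have hκc : Continuous κ := FoxH.continuous_kern A a B b
  -- A version of the integrand that is continuous on the closed interval. It is compared with the
  -- original only on the open one: at `u = x` the formula for `Q` divides by zero, and at `u = rho`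
  -- the representation of `foxH` is not available.
  set Ψ : ℝ → ℝ := fun u =>
    h (T - Real.log (u / x)) * (Real.log (u / x) * κ (Real.log (u / x))) * (1 / u) with hΨ
  have hlog : ContinuousOn (fun u : ℝ => Real.log (u / x)) (Set.Icc x r) :=
    ContinuousOn.log (by fun_prop) fun u hu => (div_pos (hx0.trans_le hu.1) hx0).ne'
  have hΨc : ContinuousOn Ψ (Set.Icc x r) := by
    refine ((hhc.comp_continuousOn (continuousOn_const.sub hlog)).mul
      (hlog.mul (hκc.comp_continuousOn hlog))).mul ?_
    exact ContinuousOn.div continuousOn_const continuousOn_id fun u hu => (hx0.trans_le hu.1).ne'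
  have hcongr : Set.EqOn (fun u => (Ψ u : ℂ))
      (fun u : ℝ => FoxH.foxH A a B b c φ₁ φ₂ u * ((FoxH.Q A a B b (x / u) / u : ℝ) : ℂ))
      (Set.Ioo x r) := by
    intro u hu
    have hu0 : 0 < u := hx0.trans hu.1
    simp only [hΨ]
    rw [(hfox u ⟨hu0, hu.2⟩).2, FoxH.Q_div_eq hA hB hmu hDelta hx0 hu.1, ← Complex.ofReal_mul]
    have : Real.log (r / u) = T - Real.log (u / x) := by
      rw [hT, Real.log_div hr0.ne' hu0.ne', Real.log_div hr0.ne' hx0.ne',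
        Real.log_div hu0.ne' hx0.ne']
      ring
    rw [this]
    congr 1
    ring
  refine ⟨(hfox x hx).1, ?_, ?_⟩
  · rw [intervalIntegrable_iff_integrableOn_Ioo_of_le hxr.le]
    refine MeasureTheory.IntegrableOn.congr_fun ?_ hcongr measurableSet_Ioo
    exact ((Complex.continuous_ofReal.comp_continuousOn hΨc).integrableOn_Icc).mono_set
      Set.Ioo_subset_Icc_self
  · have hint : ∫ u in x..r, FoxH.foxH A a B b c φ₁ φ₂ u
        * ((FoxH.Q A a B b (x / u) / u : ℝ) : ℂ)
        = ((∫ w in (0 : ℝ)..T, h w * ((T - w) * κ (T - w)) : ℝ) : ℂ) := by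
      have e1 : ∫ u in x..r, FoxH.foxH A a B b c φ₁ φ₂ u
          * ((FoxH.Q A a B b (x / u) / u : ℝ) : ℂ) = ∫ u in x..r, (Ψ u : ℂ) := by
        rw [intervalIntegral.integral_of_le hxr.le, intervalIntegral.integral_of_le hxr.le,
          MeasureTheory.integral_Ioc_eq_integral_Ioo, MeasureTheory.integral_Ioc_eq_integral_Ioo]
        exact (MeasureTheory.setIntegral_congr_fun measurableSet_Ioo hcongr).symm
      -- The substitution `v = log (u / x)` turns `du / u` into `dv`; the reflection `w = T - v`
      -- then gives the convolution in the Volterra equation.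
      have e2 : ∫ u in x..r, Ψ u = ∫ v in (0 : ℝ)..T, h (T - v) * (v * κ v) := by
        have := intervalIntegral.integral_comp_mul_deriv (a := x) (b := r)
          (f := fun u => Real.log (u / x)) (f' := fun u => 1 / u)
          (g := fun v => h (T - v) * (v * κ v)) (fun u hu => ?_) ?_ (by fun_prop)
        · rw [div_self hx0.ne', Real.log_one] at this
          exact this
        · rw [Set.uIcc_of_le hxr.le] at hu
          have hu0 : 0 < u := hx0.trans_le hu.1
          refine (((hasDerivAt_id u).div_const x).log (div_pos hu0 hx0).ne').congr_deriv ?_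
          simp only [id]
          field_simp
        · rw [Set.uIcc_of_le hxr.le]
          exact ContinuousOn.div continuousOn_const continuousOn_id
            fun u hu => (hx0.trans_le hu.1).ne'
      have e3 := intervalIntegral.integral_comp_sub_left (a := 0) (b := T)
        (fun w => h w * ((T - w) * κ (T - w))) T
      simp only [sub_sub_cancel, sub_self, sub_zero] at e3
      rw [e1, intervalIntegral.integral_ofReal, e2, e3]
    rw [hint, (hfox x hx).2, FoxH.Q_div_eq hA hB hmu hDelta hx0 hxr, ← Complex.ofReal_add,
      ← heq T hT0]
    push_cast
    have : (T : ℂ) ≠ 0 := by exact_mod_cast hT0.ne'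
    field_simp
    rw [← hT]
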